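/- **Setting.** Let $\Gamma$ be a torsionless grading monoid, i.e. a commutative cancellative monoid (written additively) whose quotient group is torsion-free. Let $R=\bigoplus_{\alpha\in\Gamma}R_\alpha$ be a $\Gamma$-graded integral domain with quotient field $K$, let $H$ be the set of nonzero homogeneous elements of $R$, and let $R_H\subseteq K$ be the homogeneous quotient field. For $f\in R$ let $C(f)$ be the (fractional) ideal of $R$ generated by the homogeneous components of $f$. A fractional ideal $E$ of $R$ is *homogeneous* if $sE$ is a homogeneous ideal of $R$ for some $s\in H$. A *semistar operation* on $R$ is a map $E\mapsto E^\star$ from the nonzero $R$-submodules of $K$ to themselves such that, for all nonzero $x\in K$ and all $E,F$: $(xE)^\star=xE^\star$; $E\subseteq F$ implies $E^\star\subseteq F^\star$; $E\subseteq E^\star$ and $(E^\star)^\star=E^\star$. (We put $0^\star=0$.) The *e.a.b. semistar operation $\star_a$ associated to $\star$* is given by $$F^{\star_a}=\bigcup\{((FG)^\star:_K G^\star)\mid G\text{ a nonzero finitely generated } R\text{-submodule of }K\}$$ for $F$ finitely generated and nonzero, and $E^{\star_a}=\bigcup\{F^{\star_a}\mid 0\ne F\subseteq E,\ F\text{ finitely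 generated}\}$ in general. We say that *$\star$ sends homogeneous fractional ideals to homogeneous ones* if, for every nonzero homogeneous fractional ideal $E$ of $R$, $E^\star$ is a homogeneous (i.e. graded) $R$-submodule of $R_H$. **Theorem.** Suppose that $R$ has a (homogeneous) unit of nonzero degree and that $\star$ is a semistar operation on $R$ which sends homogeneous fractional ideals to homogeneous ones. For any semistar operation $*$ on $R$ put $$\mathrm{Kr}(R,*):=\left\{\tfrac fg\ \middle|\ f,g\in R,\ g\neq0,\ \text{and there is } 0\ne h\in R \text{ such that } C(f)C(h)\subseteq (C(g)C(h))^{*}\right\}\subseteq K .$$ Then: 1. $\mathrm{Kr}(R,\star)=\mathrm{Kr}(R,\star_a)$. 2. $\mathrm{Kr}(R,\star)$ is a subring of $K$ and is a Bézout domain. 3. $I\,\mathrm{Kr}(R,\star)\cap R_H=I^{\star_a}$ for every nonzero finitely generated homogeneous ideal $I$ of $R$. 4. If $f,g\in R$ are such that $f$, $g$ and $f+g$ are nonzero and $C(f+g)^\star=(C(f)+C(g))^\star$, then $(f,g)\,\mathrm{Kr}(R,\star)=(f+g)\,\mathrm{Kr}(R,\star)$. In particular, $f\,\mathrm{Kr}(R,\star)=C(f)\,\mathrm{Kr}(R,\star)$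 for all $f\in R$. -/

import Mathlib

open scoped Pointwise

/-- A semistar operation on the domain `R` with quotient field `K`. Semistar operations act on the
nonzero `R`-submodules of `K`; here such a map is extended to the zero submodule by `0 ↦ 0`, which
is compatible with (and adds nothing to) the three axioms. -/
structure SemistarOperation (R K : Type*) [CommRing R] [Field K] [Algebra R K] where
  toFun : Submodule R K → Submodule R K
  map_bot : toFun ⊥ = ⊥
  map_smul : ∀ (x : K), x ≠ 0 → ∀ E : Submodule R K, toFun (x • E) = x • toFun E
  mono : ∀ {E F : Submodule R K}, E ≤ F → toFun E ≤ toFun F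
  le_self : ∀ E : Submodule R K, E ≤ toFun E
  idem : ∀ E : Submodule R K, toFun (toFun E) = toFun E

namespace SemistarOperation

variable {R K : Type*} [CommRing R] [Field K] [Algebra R K]

instance : CoeFun (SemistarOperation R K) (fun _ => Submodule R K → Submodule R K) := ⟨toFun⟩

/-- `((F H)^⋆ : H^⋆)`, united over all nonzero finitely generated `H`: the value of the e.a.b.
operation associated to `⋆` at a finitely generated `F`. -/
def eabFG (star : SemistarOperation R K) (F : Submodule R K) : Set K :=
  {x | ∃ H : Submodule R K, H.FG ∧ H ≠ ⊥ ∧ x ∈ star (F * H) / star H}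

theorem star_mul_le (star : SemistarOperation R K) (E F : Submodule R K) :
    star E * F ≤ star (E * F) := by
  rw [Submodule.mul_le]
  intro a ha y hy
  by_cases h0 : y = 0
  · simp [h0]
  have h1 : y • E ≤ E * F := by
    rintro _ ⟨e, he, rfl⟩
    change y * e ∈ _
    rw [mul_comm y e]
    exact Submodule.mul_mem_mul he hy
  have h2 : y • star E ≤ star (E * F) := by
    rw [← star.map_smul y h0]
    exact star.mono h1
  rw [mul_comm a y]
  exact h2 (Submodule.smul_mem_pointwise_smul a y _ ha)

theorem mem_div_star_iff (star : SemistarOperation R K) (F H : Submodule R K) (x : K) :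
    x ∈ star (F * H) / star H ↔ ∀ y ∈ H, x * y ∈ star (F * H) := by
  rw [Submodule.mem_div_iff_forall_mul_mem]
  refine ⟨fun h y hy => h y (star.le_self H hy), fun h y hy => ?_⟩
  by_cases h0 : x = 0
  · simp [h0]
  have h1 : x • H ≤ star (F * H) := by
    rintro _ ⟨e, he, rfl⟩
    exact h e he
  have h2 := star.mono h1
  rw [star.map_smul x h0, star.idem] at h2
  exact h2 (Submodule.smul_mem_pointwise_smul y x _ hy)

theorem mem_div_star_mul (star : SemistarOperation R K) {F F' H G : Submodule R K} (hF : F ≤ F')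
    {x : K} (hx : x ∈ star (F * H) / star H) :
    x ∈ star (F' * (H * G)) / star (H * G) := by
  rw [mem_div_star_iff] at hx ⊢
  intro y hy
  induction hy using Submodule.mul_induction_on' with
  | mem_mul_mem a ha b hb =>
    have h1 := star.star_mul_le _ _ (Submodule.mul_mem_mul (hx a ha) hb)
    rw [mul_assoc x a b] at h1
    refine star.mono ?_ h1
    rw [mul_assoc F H G]
    exact mul_le_mul_left hF _
  | add a _ b _ iha ihb =>
    rw [mul_add]
    exact add_mem iha ihb

theorem mul_ne_bot {G H : Submodule R K} (hG : G ≠ ⊥) (hH : H ≠ ⊥) : G * H ≠ ⊥ := by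
  obtain ⟨g, hg, g0⟩ := (Submodule.ne_bot_iff _).1 hG
  obtain ⟨h, hh, h0⟩ := (Submodule.ne_bot_iff _).1 hH
  exact (Submodule.ne_bot_iff _).2 ⟨g * h, Submodule.mul_mem_mul hg hh, mul_ne_zero g0 h0⟩

theorem eabFG_mono (star : SemistarOperation R K) {F F' : Submodule R K} (h : F ≤ F') :
    star.eabFG F ⊆ star.eabFG F' := by
  rintro x ⟨H, h1, h2, h3⟩
  refine ⟨H, h1, h2, ?_⟩
  rw [mem_div_star_iff] at h3 ⊢
  exact fun y hy => star.mono (mul_le_mul_left h _) (h3 y hy)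

/-- The union of the sets `F^⋆_a` over all finitely generated `F ≤ E`, as a submodule of `K`. -/
def eabSubmodule (star : SemistarOperation R K) (E : Submodule R K) : Submodule R K where
  carrier := {x | ∃ F : Submodule R K, F ≤ E ∧ F.FG ∧ x ∈ star.eabFG F}
  zero_mem' := ⟨⊥, bot_le, Submodule.fg_bot, R ∙ (1 : K), Submodule.fg_span_singleton _,
    by simp, zero_mem _⟩
  add_mem' := by
    rintro a b ⟨F, hF, hF', H, hH, hH', ha⟩ ⟨G, hG, hG', L, hL, hL', hb⟩
    refine ⟨F ⊔ G, sup_le hF hG, hF'.sup hG', H * L, hH.mul hL, mul_ne_bot hH' hL', add_mem ?_ ?_⟩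
    · exact star.mem_div_star_mul le_sup_left ha
    · rw [mul_comm H L]
      exact star.mem_div_star_mul le_sup_right hb
  smul_mem' := by
    rintro c x ⟨F, hF, hF', H, hH, hH', ha⟩
    exact ⟨F, hF, hF', H, hH, hH', Submodule.smul_mem _ _ ha⟩

theorem eabSubmodule_of_fg (star : SemistarOperation R K) {F : Submodule R K} (hF : F.FG) :
    (star.eabSubmodule F : Set K) = star.eabFG F :=
  Set.Subset.antisymm (fun _ ⟨_, h1, _, h3⟩ => star.eabFG_mono h1 h3)
    (fun _ hx => ⟨F, le_rfl, hF, hx⟩)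

theorem smul_eabSubmodule_le (star : SemistarOperation R K) {x : K} (hx : x ≠ 0)
    (E : Submodule R K) : x • star.eabSubmodule E ≤ star.eabSubmodule (x • E) := by
  rintro _ ⟨y, ⟨F, hF, hF', H, hH, hH', hy⟩, rfl⟩
  refine ⟨x • F, Submodule.map_mono hF, hF'.map _, H, hH, hH', ?_⟩
  rw [mem_div_star_iff] at hy ⊢
  intro z hz
  have h1 : x • star (F * H) ≤ star ((x • F) * H) := by
    rw [← star.map_smul x hx]
    refine star.mono ?_
    rintro _ ⟨w, hw, rfl⟩
    change x * w ∈ _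
    induction hw using Submodule.mul_induction_on' with
    | mem_mul_mem a ha b hb =>
      rw [← mul_assoc]
      exact Submodule.mul_mem_mul (Submodule.smul_mem_pointwise_smul a x _ ha) hb
    | add a _ b _ iha ihb =>
      rw [mul_add]
      exact add_mem iha ihb
  have h2 := h1 (Submodule.smul_mem_pointwise_smul _ x _ (hy z hz))
  rw [smul_eq_mul, ← mul_assoc] at h2
  exact h2

/-- Finitely many elements of `E^⋆_a` are captured by one pair `F, H`. -/
theorem exists_common (star : SemistarOperation R K) {E G : Submodule R K} (hG : G.FG)
    (hGE : G ≤ star.eabSubmodule E) : ∃ F : Submodule R K, F ≤ E ∧ F.FG ∧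
      ∃ H : Submodule R K, H.FG ∧ H ≠ ⊥ ∧ G ≤ star (F * H) / star H := by
  induction G, hG using Submodule.fg_induction with
  | singleton x =>
    obtain ⟨F, h1, h2, H, h3, h4, h5⟩ := hGE (Submodule.mem_span_singleton_self x)
    exact ⟨F, h1, h2, H, h3, h4, by simpa [Submodule.span_le] using h5⟩
  | sup G₁ G₂ _ _ ih₁ ih₂ =>
    obtain ⟨F, h1, h2, H, h3, h4, h5⟩ := ih₁ (le_sup_left.trans hGE)
    obtain ⟨F', k1, k2, H', k3, k4, k5⟩ := ih₂ (le_sup_right.trans hGE)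
    refine ⟨F ⊔ F', sup_le h1 k1, h2.sup k2, H * H', h3.mul k3, mul_ne_bot h4 k4, sup_le ?_ ?_⟩
    · exact fun x hx => star.mem_div_star_mul le_sup_left (h5 hx)
    · rw [mul_comm H H']
      exact fun x hx => star.mem_div_star_mul le_sup_right (k5 hx)

/-- The e.a.b. semistar operation of finite type `⋆_a` associated to `⋆`. -/
def eab (star : SemistarOperation R K) : SemistarOperation R K where
  toFun := star.eabSubmodule
  map_bot := by
    rw [eq_bot_iff]
    rintro x ⟨F, hF, -, H, -, hH, hx⟩
    obtain rfl : F = ⊥ := le_bot_iff.1 hF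
    rw [mem_div_star_iff] at hx
    obtain ⟨h, hh, h0⟩ := (Submodule.ne_bot_iff _).1 hH
    have := hx h hh
    rw [Submodule.bot_mul, star.map_bot, Submodule.mem_bot] at this
    simpa [h0] using this
  map_smul x hx E := by
    refine le_antisymm ?_ (star.smul_eabSubmodule_le hx E)
    intro y hy
    have h1 := star.smul_eabSubmodule_le (inv_ne_zero hx) (x • E)
      (Submodule.smul_mem_pointwise_smul y x⁻¹ _ hy)
    rw [smul_smul, inv_mul_cancel₀ hx, one_smul] at h1
    have h2 := Submodule.smul_mem_pointwise_smul _ x _ h1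
    rwa [smul_smul, mul_inv_cancel₀ hx, one_smul] at h2
  mono := fun h _ ⟨F, h1, h2⟩ => ⟨F, h1.trans h, h2⟩
  le_self E x hx := by
    refine ⟨R ∙ x, by simpa using hx, Submodule.fg_span_singleton _, R ∙ (1 : K),
      Submodule.fg_span_singleton _, by simp, ?_⟩
    rw [mem_div_star_iff]
    intro y hy
    exact star.le_self _ (Submodule.mul_mem_mul (Submodule.mem_span_singleton_self x) hy)
  idem E := by
    refine le_antisymm ?_ ?_
    · rintro x ⟨G, hG, hG', L, hL, hL', hx⟩
      obtain ⟨F, h1, h2, H, h3, h4, h5⟩ := star.exists_common hG' hG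
      refine ⟨F, h1, h2, H * L, h3.mul hL, mul_ne_bot h4 hL', ?_⟩
      have hx' := star.mem_div_star_mul (G := H) le_rfl hx
      rw [mul_comm L H] at hx'
      rw [mem_div_star_iff] at hx' ⊢
      intro y hy
      refine (?_ : star (G * (H * L)) ≤ star (F * (H * L))) (hx' y hy)
      rw [← star.idem (F * (H * L))]
      refine star.mono ?_
      rw [← mul_assoc, ← mul_assoc]
      refine le_trans (mul_le_mul_left (?_ : G * H ≤ star (F * H)) L) (star.star_mul_le _ _)
      rw [Submodule.mul_le]
      intro g hg h hh
      exact (star.mem_div_star_iff F H g).1 (h5 hg) h hh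
    · intro x hx
      refine ⟨R ∙ x, by simpa using hx, Submodule.fg_span_singleton _, R ∙ (1 : K),
        Submodule.fg_span_singleton _, by simp, ?_⟩
      rw [mem_div_star_iff]
      intro y hy
      exact star.le_self _ (Submodule.mul_mem_mul (Submodule.mem_span_singleton_self x) hy)

end SemistarOperation

namespace GradedKronecker

variable {Γ R : Type*} [AddCommMonoid Γ] [DecidableEq Γ] [CommRing R]
  (𝒜 : Γ → AddSubgroup R) [GradedRing 𝒜]
  (K : Type*) [Field K] [Algebra R K]

/-- The homogeneous elements (including `0`) of `R_H`, inside the quotient field `K` of `R`: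
quotients `a / s` of a homogeneous `a` by a nonzero homogeneous `s`. -/
def homogeneousFractions : Set K :=
  {x | ∃ a s : R, SetLike.IsHomogeneousElem 𝒜 a ∧ SetLike.IsHomogeneousElem 𝒜 s ∧ s ≠ 0 ∧
    x = algebraMap R K a / algebraMap R K s}

/-- The homogeneous quotient field `R_H`, as a subset of the quotient field `K` of `R`. -/
def homogeneousQuotientField : Set K :=
  {x | ∃ a s : R, SetLike.IsHomogeneousElem 𝒜 s ∧ s ≠ 0 ∧
    x = algebraMap R K a / algebraMap R K s}

/-- `C(f)`: the fractional ideal generated by the homogeneous components of `f`. -/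
def content (f : R) : Submodule R K :=
  Submodule.span R (Set.range fun i : Γ => algebraMap R K (DirectSum.decompose 𝒜 f i : R))

variable {K}

/-- `E` is a homogeneous fractional ideal: `s E` is an integral homogeneous ideal of `R` for some
nonzero homogeneous `s`. -/
def IsHomogeneousFractionalIdeal (E : Submodule R K) : Prop :=
  ∃ s : R, SetLike.IsHomogeneousElem 𝒜 s ∧ s ≠ 0 ∧
    ∃ I : Ideal R, I.IsHomogeneous 𝒜 ∧ algebraMap R K s • E = IsLocalization.coeSubmodule K I

/-- `E` is a homogeneous (that is, graded) `R`-submodule of `R_H`: it is generated by the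
homogeneous elements of `R_H` that it contains. No denominator common to all of `E` is required. -/
def IsHomogeneousSubmodule (E : Submodule R K) : Prop :=
  Submodule.span R ((E : Set K) ∩ homogeneousFractions 𝒜 K) = E

/-- `⋆` sends homogeneous fractional ideals to homogeneous ones. -/
def PreservesHomogeneous (star : SemistarOperation R K) : Prop :=
  ∀ E : Submodule R K, E ≠ ⊥ → IsHomogeneousFractionalIdeal 𝒜 E → IsHomogeneousSubmodule 𝒜 (star E)

/-- The underlying set of the Kronecker function ring `Kr(R, ⋆)`. -/
def kr (star : SemistarOperation R K) : Set K :=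
  {x | ∃ f g : R, g ≠ 0 ∧ x = algebraMap R K f / algebraMap R K g ∧
    ∃ h : R, h ≠ 0 ∧
      content 𝒜 K f * content 𝒜 K h ≤ star (content 𝒜 K g * content 𝒜 K h)}

end GradedKronecker

/-! Everything rests on replacing the condition "some `h ≠ 0` has C(f)C(h) ⊆ (C(g)C(h))^⋆" by C(f) ⊆
C(g)^{⋆_a} (`content_le_eab_iff`). The forward direction is cancellation under ⋆_a. For the
converse, ⋆_a supplies an arbitrary finitely generated module H instead of a content. Scale H into
R; a homogeneous unit u of nonzero degree lets one element h have as content the sum of the contents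
of the generators (multiplying by powers of u separates degrees). Since ⋆ preserves homogeneity, an
inclusion known for the generators passes to their components.

The second ingredient is a Gauss lemma, C(f)C(g) ⊆ C(fg)^{⋆_a}: the Dedekind–Mertens lemma gives it
after multiplication by a power of C(f), which ⋆_a cancels. Hence membership of f/g in Kr does not
depend on the representative and Kr is a ring. It is Bézout because f/d and g/d generate the same
ideal as (f + uⁿg)/d when C(f + uⁿg) = C(f) + C(g).

For the trace on R_H, write I = C(f). Then a/s lies in f·Kr iff C(a) ⊆ sC(f)^{⋆_a}, which
homogeneity reduces to a ∈ sC(f)^{⋆_a}. It remains that I^{⋆_a} ⊆ R_H. An element x of I^{⋆_a}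
satisfies xH^⋆ ⊆ H^⋆ for some H, so r·xⁿ ∈ R_H for all n with a fixed r ≠ 0, and R_H is completely
integrally closed in K. The latter is proved by mapping R into the group algebra K[G], where G is
the quotient group of Γ: nonzero homogeneous elements become units, and K[G] is a directed union of
Laurent polynomial rings, which are factorial. -/

/-! ### Divisibility in group algebras of torsion-free groups. -/

/-- After cancelling the common factor of p and q, every power of the reduced q' divides `h`. A
nonzero element has only finitely many powers of a nonunit as divisors, so q' is a unit. -/
theorem UniqueFactorizationMonoid.dvd_of_forall_pow_dvd_mul_pow {A : Type*} [CommRing A] [IsDomain A]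
    [UniqueFactorizationMonoid A] {h p q : A} (hh : h ≠ 0) (H : ∀ n : ℕ, q ^ n ∣ h * p ^ n) :
    q ∣ p := by
  classical
  by_cases hq : q = 0
  · have := H 1
    rw [hq, pow_one, zero_dvd_iff, pow_one] at this
    rw [(mul_eq_zero.1 this).resolve_left hh]
    exact dvd_zero _
  obtain ⟨p', q', c, hrel, rfl, rfl⟩ := UniqueFactorizationMonoid.exists_reduced_factors' p q hq
  have hc : c ≠ 0 := left_ne_zero_of_mul hq
  have key : ∀ n : ℕ, q' ^ n ∣ h := fun n => by
    have h1 := H n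
    rw [mul_pow, mul_pow, mul_left_comm] at h1
    exact (hrel.symm.pow (m := n) (n := n)).dvd_of_dvd_mul_right
      ((mul_dvd_mul_iff_left (pow_ne_zero n hc)).1 h1)
  have hu : IsUnit q' := by
    by_contra hu
    obtain ⟨n, hn⟩ := FiniteMultiplicity.of_not_isUnit hu hh
    exact hn (key _)
  exact mul_dvd_mul_left _ (hu.dvd)

namespace AddMonoidAlgebra

/-- Splitting off one coordinate gives Laurent polynomials over the previous algebra, a localization
of a polynomial ring; factoriality passes to both. -/
theorem uniqueFactorizationMonoid_fin (k : Type*) [Field k] (n : ℕ) :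
    IsDomain (AddMonoidAlgebra k (Fin n → ℤ)) ∧
      UniqueFactorizationMonoid (AddMonoidAlgebra k (Fin n → ℤ)) := by
  induction n with
  | zero =>
    let e : AddMonoidAlgebra k (Fin 0 → ℤ) ≃+* k := uniqueRingEquiv (Fin 0 → ℤ)
    exact ⟨e.toMulEquiv.isDomain k, e.symm.toMulEquiv.uniqueFactorizationMonoid inferInstance⟩
  | succ n ih =>
    obtain ⟨_, _⟩ := ih
    let B := AddMonoidAlgebra k (Fin n → ℤ)
    let e1 : AddMonoidAlgebra k (Fin (n + 1) → ℤ) ≃+* AddMonoidAlgebra k (ℤ × (Fin n → ℤ)) :=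
      mapDomainRingEquiv k { (Fin.consEquiv (fun _ => ℤ)).symm with map_add' := fun _ _ => rfl }
    let e : AddMonoidAlgebra k (Fin (n + 1) → ℤ) ≃+* LaurentPolynomial B := e1.trans curryRingEquiv
    have : UniqueFactorizationMonoid (LaurentPolynomial B) :=
      UniqueFactorizationMonoid.of_isLocalization (Submonoid.powers (Polynomial.X : Polynomial B)) _
    exact ⟨e.toMulEquiv.isDomain (LaurentPolynomial B),
      e.symm.toMulEquiv.uniqueFactorizationMonoid inferInstance⟩

/-- Translation by an element of H preserves H and its complement, so discarding the exponents
outside H is k[H]-linear. This lets a divisibility in k[G] descend to k[H]. -/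
theorem comapDomain_mapDomain_mul {k G H : Type*} [CommRing k] [AddCommGroup G] [AddCommGroup H]
    (f : H →+ G) (hf : Function.Injective f) (a : AddMonoidAlgebra k H) (y : AddMonoidAlgebra k G) :
    comapDomain f hf (mapDomain f a * y) = a * comapDomain f hf y := by
  induction a using induction_linear with
  | zero => simp
  | add a b iha ihb => simp [mapDomain_add, add_mul, iha, ihb]
  | single m r =>
    ext g
    simp [coeff_single_mul_apply]

/-- Only finitely many exponents occur. They generate a finitely generated torsion-free, hence free,
subgroup, whose group algebra is factorial. -/
theorem dvd_of_forall_pow_dvd_mul_pow {k G : Type*} [Field k] [AddCommGroup G] [IsAddTorsionFree G]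
    {h p q : AddMonoidAlgebra k G} (hh : h ≠ 0) (H : ∀ n : ℕ, q ^ n ∣ h * p ^ n) : q ∣ p := by
  classical
  let S : Finset G := h.coeff.support ∪ p.coeff.support ∪ q.coeff.support
  let G₀ : AddSubgroup G := AddSubgroup.closure (S : Set G)
  have : AddGroup.FG G₀ := (AddGroup.fg_iff_addSubgroup_fg _).2 ⟨S, rfl⟩
  have : Module.Finite ℤ G₀ := Module.Finite.iff_addGroup_fg.2 inferInstance
  have e : G₀ ≃+ (Fin (Module.finrank ℤ G₀) → ℤ) := (Module.finBasis ℤ G₀).equivFun.toAddEquiv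
  obtain ⟨_, _⟩ := uniqueFactorizationMonoid_fin k (Module.finrank ℤ G₀)
  have : IsDomain (AddMonoidAlgebra k G₀) := (mapDomainRingEquiv k e).toMulEquiv.isDomain _
  have : UniqueFactorizationMonoid (AddMonoidAlgebra k G₀) :=
    (mapDomainRingEquiv k e).symm.toMulEquiv.uniqueFactorizationMonoid inferInstance
  let f : G₀ →+ G := G₀.subtype
  have hf : Function.Injective f := Subtype.val_injective
  have lift : ∀ x : AddMonoidAlgebra k G, x.coeff.support ⊆ S →
      mapDomainRingHom k f (comapDomain f hf x) = x := fun x hx => by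
    refine mapDomain_comapDomain (fun i hi => ?_) hf
    exact ⟨⟨i, AddSubgroup.subset_closure (hx hi)⟩, rfl⟩
  have lh := lift h (fun i hi => by simp only [S, Finset.mem_union]; tauto)
  have lp := lift p (fun i hi => by simp only [S, Finset.mem_union]; tauto)
  have lq := lift q (fun i hi => by simp only [S, Finset.mem_union]; tauto)
  have hdvd : comapDomain f hf q ∣ comapDomain f hf p := by
    refine UniqueFactorizationMonoid.dvd_of_forall_pow_dvd_mul_pow (h := comapDomain f hf h) ?_ ?_
    · intro h0
      rw [h0, map_zero] at lh
      exact hh lh.symm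
    · intro n
      obtain ⟨y, hy⟩ := H n
      refine ⟨comapDomain f hf y, ?_⟩
      rw [← comapDomain_mapDomain_mul]
      have h1 : mapDomain f (comapDomain f hf q ^ n) = q ^ n := by
        change mapDomainRingHom k f _ = _
        rw [map_pow, lq]
      have h2 : mapDomain f (comapDomain f hf h * comapDomain f hf p ^ n) = h * p ^ n := by
        change mapDomainRingHom k f _ = _
        rw [map_mul, map_pow, lh, lp]
      rw [h1, ← hy, ← h2]
      ext g
      simp [mapDomain, Finsupp.mapDomain_apply hf]
  rw [← lq, ← lp]
  exact map_dvd _ hdvd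

end AddMonoidAlgebra

/-! ### Unique sums in torsionless monoids. -/

theorem uniqueSums_of_isAddTorsionFree (Γ : Type*) [AddCancelCommMonoid Γ] [IsAddTorsionFree Γ] :
    UniqueSums Γ where
  uniqueAdd_of_nonempty {A B} hA hB := by
    classical
    -- The claim involves only A and B, so it suffices to work in the finitely generated submonoid
    -- they span, which is an affine monoid.
    let N : AddSubmonoid Γ := AddSubmonoid.closure ((A ∪ B : Finset Γ) : Set Γ)
    have : AddMonoid.FG N := (AddMonoid.fg_iff_addSubmonoid_fg _).2 ⟨A ∪ B, rfl⟩
    have : IsAddTorsionFree N := Subtype.val_injective.isAddTorsionFree N.subtype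
    let _ : AddCancelCommMonoid N :=
      { (inferInstance : AddCommMonoid N) with
        add_left_cancel := fun a b c h => Subtype.ext (add_left_cancel (congrArg Subtype.val h)) }
    have : TwoUniqueSums N := AffineAddMonoid.to_twoUniqueSums
    have hsub : ∀ i ∈ A ∪ B, i ∈ N := fun i hi => AddSubmonoid.subset_closure hi
    have hinj : Function.Injective (Subtype.val : N → Γ) := Subtype.val_injective
    have hA' : (A.preimage (Subtype.val : N → Γ) hinj.injOn).Nonempty := by
      obtain ⟨a, ha⟩ := hA
      exact ⟨⟨a, hsub a (Finset.mem_union_left _ ha)⟩, by simpa using ha⟩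
    have hB' : (B.preimage (Subtype.val : N → Γ) hinj.injOn).Nonempty := by
      obtain ⟨a, ha⟩ := hB
      exact ⟨⟨a, hsub a (Finset.mem_union_right _ ha)⟩, by simpa using ha⟩
    obtain ⟨a, ha, b, hb, hab⟩ := UniqueSums.uniqueAdd_of_nonempty hA' hB'
    refine ⟨a, by simpa using ha, b, by simpa using hb, fun i j hi hj hij => ?_⟩
    have := @hab ⟨i, hsub i (Finset.mem_union_left _ hi)⟩ ⟨j, hsub j (Finset.mem_union_right _ hj)⟩
      (by simpa using hi) (by simpa using hj) (Subtype.ext hij)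
    exact ⟨congrArg Subtype.val this.1, congrArg Subtype.val this.2⟩

theorem AddMonoidAlgebra.coeff_mul_of_uniqueAdd {k G : Type*} [CommRing k] [AddCommGroup G]
    {x y : AddMonoidAlgebra k G} {i j : G}
    (h : UniqueAdd x.coeff.support y.coeff.support i j) :
    (x * y).coeff (i + j) = x.coeff i * y.coeff j := by
  classical
  rw [AddMonoidAlgebra.coeff_mul, Finsupp.sum, Finset.sum_eq_single i]
  · rw [Finsupp.sum, Finset.sum_eq_single j]
    · simp
    · intro b hb hbj
      by_cases hi : i ∈ x.coeff.support
      · rw [if_neg]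
        exact fun e => hbj (h hi hb e).2
      · simp [Finsupp.notMem_support_iff.1 hi]
    · intro hj
      simp [Finsupp.notMem_support_iff.1 hj]
  · intro a ha hai
    refine Finset.sum_eq_zero fun b hb => if_neg ?_
    exact fun e => hai (h ha hb e).1
  · intro hi
    simp [Finsupp.notMem_support_iff.1 hi, Finsupp.sum]

/-! ### The map from R to K[G] and complete integral closedness of R_H. -/

namespace GradedKronecker

section coaction

variable {Γ R K G : Type*} [AddCancelCommMonoid Γ] [DecidableEq Γ] [CommRing R]
  (𝒜 : Γ → AddSubgroup R) [GradedRing 𝒜] (K) [Field K] [Algebra R K]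
  [AddCommGroup G] (ι : Γ →+ G)

/-- The ring homomorphism `R → K[G]` sending `f` to `∑ fᵢ Xⁱ`, where the `fᵢ` are the homogeneous
components of `f`. -/
noncomputable def coaction : R →+* AddMonoidAlgebra K G :=
  (DirectSum.toSemiring
    (fun i => (AddMonoidAlgebra.singleAddHom (ι i)).comp
      ((algebraMap R K).toAddMonoidHom.comp (𝒜 i).subtype))
    (by simp [AddMonoidAlgebra.one_def])
    (by intro i j a b; simp [AddMonoidAlgebra.single_mul_single])).comp
  (DirectSum.decomposeRingEquiv 𝒜 : R →+* _)

theorem coaction_of_mem {i : Γ} {a : R} (ha : a ∈ 𝒜 i) :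
    coaction 𝒜 K ι a = AddMonoidAlgebra.single (ι i) (algebraMap R K a) := by
  have h : DirectSum.decomposeRingEquiv 𝒜 a = DirectSum.of _ i ⟨a, ha⟩ :=
    DirectSum.decompose_of_mem 𝒜 ha
  simp [coaction, h]

variable {ι}

theorem coeff_coaction (hι : Function.Injective ι) (f : R) (i : Γ) :
    (coaction 𝒜 K ι f).coeff (ι i) = algebraMap R K (DirectSum.decompose 𝒜 f i) := by
  induction f using DirectSum.Decomposition.inductionOn 𝒜 with
  | zero => simp
  | homogeneous m =>
    rename_i j
    rw [coaction_of_mem 𝒜 K ι m.2]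
    by_cases hij : j = i
    · subst hij
      simp
    · rw [DirectSum.decompose_of_mem_ne 𝒜 m.2 hij]
      simp [hι.eq_iff, hij]
  | add a b ha hb => simp [ha, hb]

theorem exists_of_coeff_coaction_ne_zero {f : R} {g : G} (h : (coaction 𝒜 K ι f).coeff g ≠ 0) :
    ∃ i, ι i = g := by
  contrapose! h
  induction f using DirectSum.Decomposition.inductionOn 𝒜 with
  | zero => simp
  | homogeneous m =>
    rename_i j
    rw [coaction_of_mem 𝒜 K ι m.2]
    simp [h j]
  | add a b ha hb => simp [ha, hb]

variable [FaithfulSMul R K]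

theorem coaction_injective (hι : Function.Injective ι) : Function.Injective (coaction 𝒜 K ι) := by
  rw [injective_iff_map_eq_zero]
  intro f hf
  have : DirectSum.decompose 𝒜 f = 0 := by
    ext i
    have := coeff_coaction 𝒜 K hι f i
    rw [hf] at this
    simpa using this.symm
  exact (DirectSum.decompose 𝒜).injective (this.trans (DirectSum.decompose_zero 𝒜).symm)

theorem isUnit_coaction {i : Γ} {s : R} (hs : s ∈ 𝒜 i) (hs0 : s ≠ 0) :
    IsUnit (coaction 𝒜 K ι s) := by
  rw [coaction_of_mem 𝒜 K ι hs]
  refine IsUnit.of_mul_eq_one (AddMonoidAlgebra.single (-ι i) (algebraMap R K s)⁻¹) ?_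
  rw [AddMonoidAlgebra.single_mul_single, add_neg_cancel, mul_inv_cancel₀ (by simpa using hs0)]
  rfl

variable [IsDomain R] [IsAddTorsionFree G]

/-- If the image of `q` divides that of `p` in `K[G]` then `q` divides `p` up to a homogeneous
factor. -/
theorem exists_dvd_homogeneous_mul (hι : Function.Injective ι) {q : R} (hq : q ≠ 0) (p : R)
    (c : AddMonoidAlgebra K G) (h : coaction 𝒜 K ι q * c = coaction 𝒜 K ι p) :
    ∃ s : R, SetLike.IsHomogeneousElem 𝒜 s ∧ s ≠ 0 ∧ q ∣ s * p := by
  classical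
  -- Long division on the number of terms of c. A uniquely represented sum i + j exposes a product
  -- of single coefficients, p_k = q_i c_j. Replacing p by q_i p - p_k q removes the term c_j from
  -- the quotient at the cost of the homogeneous factor q_i.
  induction hn : c.coeff.support.card using Nat.strong_induction_on generalizing p c with
  | _ n ih =>
  subst hn
  by_cases hc : c = 0
  · have hp : p = 0 := coaction_injective 𝒜 K hι (by simp [← h, hc])
    exact ⟨1, ⟨0, SetLike.GradedOne.one_mem⟩, one_ne_zero, by simp [hp]⟩
  have := uniqueSums_of_isAddTorsionFree G
  have hδ : coaction 𝒜 K ι q ≠ 0 := fun h0 => hq (coaction_injective 𝒜 K hι (by simpa using h0))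
  obtain ⟨i, hi, j, hj, hij⟩ := UniqueSums.uniqueAdd_of_nonempty
    (Finsupp.support_nonempty_iff.2 (AddMonoidAlgebra.coeff_eq_zero.not.2 hδ))
    (Finsupp.support_nonempty_iff.2 (AddMonoidAlgebra.coeff_eq_zero.not.2 hc))
  have key := AddMonoidAlgebra.coeff_mul_of_uniqueAdd hij
  rw [Finsupp.mem_support_iff] at hi hj
  rw [h] at key
  obtain ⟨k, hk⟩ := exists_of_coeff_coaction_ne_zero 𝒜 K (key ▸ mul_ne_zero hi hj)
  obtain ⟨i, rfl⟩ := exists_of_coeff_coaction_ne_zero 𝒜 K hi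
  rw [← hk, coeff_coaction 𝒜 K hι, coeff_coaction 𝒜 K hι] at key
  rw [coeff_coaction 𝒜 K hι] at hi
  set qi := (DirectSum.decompose 𝒜 q i : R) with hqi
  set pk := (DirectSum.decompose 𝒜 p k : R) with hpk
  have hqi0 : qi ≠ 0 := fun h0 => hi (by simp [h0])
  have hqiA : qi ∈ 𝒜 i := SetLike.coe_mem _
  have hpkA : pk ∈ 𝒜 k := SetLike.coe_mem _
  let c' := AddMonoidAlgebra.single (ι i) (algebraMap R K qi) * c.erase j
  have hpk' : AddMonoidAlgebra.single (ι k) (algebraMap R K pk) =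
      AddMonoidAlgebra.single (ι i) (algebraMap R K qi) *
        AddMonoidAlgebra.single j (c.coeff j) := by
    rw [AddMonoidAlgebra.single_mul_single, hk, key]
  have hc' : coaction 𝒜 K ι q * c' = coaction 𝒜 K ι (qi * p - pk * q) := by
    rw [map_sub, map_mul, map_mul, coaction_of_mem 𝒜 K ι hqiA, coaction_of_mem 𝒜 K ι hpkA, hpk', ← h]
    linear_combination coaction 𝒜 K ι q * AddMonoidAlgebra.single (ι i) (algebraMap R K qi) *
      c.single_add_erase j
  have hcard : c'.coeff.support.card < c.coeff.support.card := by
    have h1 : c'.coeff.support ⊆ (c.coeff.support.erase j).image (fun x => ι i + x) := by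
      intro x hx
      rw [Finsupp.mem_support_iff, AddMonoidAlgebra.coeff_single_mul_apply] at hx
      refine Finset.mem_image.2 ⟨-ι i + x, ?_, by abel⟩
      have := right_ne_zero_of_mul hx
      rwa [AddMonoidAlgebra.coeff_erase, ← Finsupp.mem_support_iff, Finsupp.support_erase] at this
    calc _ ≤ _ := Finset.card_le_card h1
      _ ≤ _ := Finset.card_image_le
      _ < _ := Finset.card_erase_lt_of_mem (Finsupp.mem_support_iff.2 hj)
  obtain ⟨s, ⟨l, hs⟩, hs0, b, hb⟩ := ih _ hcard _ c' hc' rfl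
  refine ⟨s * qi, ⟨l + i, SetLike.mul_mem_graded hs hqiA⟩, mul_ne_zero hs0 hqi0, b + s * pk, ?_⟩
  linear_combination hb

end coaction

variable {Γ R K : Type*} [AddCancelCommMonoid Γ] [IsAddTorsionFree Γ] [DecidableEq Γ]
  [CommRing R] [IsDomain R] (𝒜 : Γ → AddSubgroup R) [GradedRing 𝒜]
  [Field K] [Algebra R K] [IsFractionRing R K]

/-- The homogeneous quotient field is completely integrally closed in the quotient field. -/
theorem mem_homogeneousQuotientField_of_forall_mul_pow {h : R} {x : K} (hh : h ≠ 0)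
    (H : ∀ n : ℕ, algebraMap R K h * x ^ n ∈ homogeneousQuotientField 𝒜 K) :
    x ∈ homogeneousQuotientField 𝒜 K := by
  let ι : Γ →+ Algebra.GrothendieckAddGroup Γ := Algebra.GrothendieckAddGroup.of
  have hι : Function.Injective ι := by
    intro a b hab
    obtain ⟨c, hc⟩ := (AddLocalization.addMonoidOf (⊤ : AddSubmonoid Γ)).eq_iff_exists.1 hab
    exact add_left_cancel hc
  obtain ⟨p, q, hq, rfl⟩ := IsFractionRing.div_surjective (A := R) x
  have hq0 : q ≠ 0 := nonZeroDivisors.ne_zero hq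
  have hqK : algebraMap R K q ≠ 0 := by simpa using hq0
  have hdvd : coaction 𝒜 K ι q ∣ coaction 𝒜 K ι p := by
    refine AddMonoidAlgebra.dvd_of_forall_pow_dvd_mul_pow (h := coaction 𝒜 K ι h)
      (fun h0 => hh (coaction_injective 𝒜 K hι (by simpa using h0))) fun n => ?_
    obtain ⟨a, s, ⟨i, hs⟩, hs0, e⟩ := H n
    have hsK : algebraMap R K s ≠ 0 := by simpa using hs0
    rw [div_pow, ← mul_div_assoc, div_eq_div_iff (pow_ne_zero _ hqK) hsK] at e
    have e' : h * p ^ n * s = a * q ^ n := IsFractionRing.injective R K (by simpa using e)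
    have e2 := congrArg (coaction 𝒜 K ι) e'
    simp only [map_mul, map_pow] at e2
    rw [← (isUnit_coaction 𝒜 K (ι := ι) hs hs0).dvd_mul_right, e2]
    exact dvd_mul_left _ _
  obtain ⟨c, hc⟩ := hdvd
  obtain ⟨s, hs, hs0, b, hb⟩ := exists_dvd_homogeneous_mul 𝒜 K hι hq0 p c hc.symm
  refine ⟨b, s, hs, hs0, ?_⟩
  rw [div_eq_div_iff hqK (by simpa using hs0), ← map_mul, ← map_mul]
  congr 1
  linear_combination hb

end GradedKronecker

/-! ### The Dedekind–Mertens lemma. -/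

section IdemSemiring

variable {α : Type*} [IdemCommSemiring α]

theorem pow_succ_le_add_of_le_add {F F' a : α} (hF : F ≤ F' + a) (hF' : F' ≤ F) (n : ℕ) :
    F ^ (n + 1) ≤ F' ^ (n + 1) + a * F ^ n := by
  induction n with
  | zero => simpa using hF
  | succ n ih =>
    calc F ^ (n + 1 + 1) = F ^ (n + 1) * F := pow_succ _ _
      _ ≤ (F' ^ (n + 1) + a * F ^ n) * F := mul_le_mul_left ih _
      _ = F' ^ (n + 1) * F + a * F ^ (n + 1) := by ring
      _ ≤ F' ^ (n + 1) * (F' + a) + a * F ^ (n + 1) := by gcongr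
      _ = F' ^ (n + 1 + 1) + a * F' ^ (n + 1) + a * F ^ (n + 1) := by ring
      _ ≤ F' ^ (n + 1 + 1) + a * F ^ (n + 1) + a * F ^ (n + 1) := by gcongr
      _ = F' ^ (n + 1 + 1) + a * F ^ (n + 1) := by rw [add_assoc, add_idem]

/-- The inductive step of the Dedekind–Mertens lemma. -/
theorem pow_mul_le_of_le_add {F F' G G' L L₁ L₂ a b : α} {k : ℕ} (hab : a * b ≤ L)
    (hF : F ≤ F' + a) (hF' : F' ≤ F) (ha : a ≤ F) (hG : G ≤ G' + b)
    (hL₁ : L₁ ≤ L + F * b) (hL₂ : L₂ ≤ L + a * G)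
    (ih₁ : F ^ (k + 1) * G' ≤ F ^ k * L₁) (ih₂ : F' ^ (k + 2) * G ≤ F' ^ (k + 1) * L₂) :
    F ^ (k + 2) * G ≤ F ^ (k + 1) * L := by
  -- The contribution of the removed component a: its product with G' is controlled by `ih₁`, and
  -- the error term F * b, once multiplied by a, is absorbed by a * b ≤ L.
  have hA : a * F ^ (k + 1) * G ≤ F ^ (k + 1) * L :=
    calc a * F ^ (k + 1) * G ≤ a * F ^ (k + 1) * (G' + b) := by gcongr
      _ = a * (F ^ (k + 1) * G') + F ^ (k + 1) * (a * b) := by ring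
      _ ≤ a * (F ^ k * (L + F * b)) + F ^ (k + 1) * L := by
        refine add_le_add (mul_le_mul_right (ih₁.trans ?_) _) (mul_le_mul_right hab _)
        gcongr
      _ = a * F ^ k * L + F ^ (k + 1) * (a * b) + F ^ (k + 1) * L := by ring
      _ ≤ F * F ^ k * L + F ^ (k + 1) * L + F ^ (k + 1) * L := by gcongr
      _ = F ^ (k + 1) * L := by rw [← pow_succ', add_idem, add_idem]
  calc F ^ (k + 2) * G ≤ (F' ^ (k + 2) + a * F ^ (k + 1)) * G := by
        gcongr
        exact pow_succ_le_add_of_le_add hF hF' (k + 1)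
    _ = F' ^ (k + 2) * G + a * F ^ (k + 1) * G := by ring
    _ ≤ F' ^ (k + 1) * (L + a * G) + F ^ (k + 1) * L := by
      refine add_le_add (ih₂.trans ?_) hA
      gcongr
    _ ≤ F ^ (k + 1) * (L + a * G) + F ^ (k + 1) * L := by gcongr
    _ = F ^ (k + 1) * L + a * F ^ (k + 1) * G + F ^ (k + 1) * L := by ring
    _ ≤ F ^ (k + 1) * L + F ^ (k + 1) * L + F ^ (k + 1) * L := by gcongr
    _ = F ^ (k + 1) * L := by rw [add_idem, add_idem]

end IdemSemiring

namespace GradedKronecker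

variable {Γ R : Type*} [AddCancelCommMonoid Γ] [DecidableEq Γ] [CommRing R]
  (𝒜 : Γ → AddSubgroup R) [GradedRing 𝒜]

theorem exists_finset_decompose (f : R) :
    ∃ A : Finset Γ, ∀ i ∉ A, (DirectSum.decompose 𝒜 f i : R) = 0 := by
  classical
  exact ⟨(DirectSum.decompose 𝒜 f).support, fun i hi => by simpa using hi⟩

theorem sum_decompose {f : R} {A : Finset Γ} (hA : ∀ i ∉ A, (DirectSum.decompose 𝒜 f i : R) = 0) :
    ∑ i ∈ A, (DirectSum.decompose 𝒜 f i : R) = f := by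
  classical
  conv_rhs => rw [← DirectSum.sum_support_decompose 𝒜 f]
  refine (Finset.sum_subset (fun i hi => ?_) fun i _ hi => by simpa using hi).symm
  by_contra h
  exact (DFinsupp.mem_support_iff.1 hi) (Subtype.ext (hA i h))

theorem decompose_mul_eq_sum {f g : R} {A B : Finset Γ}
    (hA : ∀ i ∉ A, (DirectSum.decompose 𝒜 f i : R) = 0)
    (hB : ∀ i ∉ B, (DirectSum.decompose 𝒜 g i : R) = 0) (k : Γ) :
    (DirectSum.decompose 𝒜 (f * g) k : R) = ∑ i ∈ A, ∑ j ∈ B,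
      if i + j = k then (DirectSum.decompose 𝒜 f i * DirectSum.decompose 𝒜 g j : R) else 0 := by
  conv_lhs => rw [← sum_decompose 𝒜 hA, ← sum_decompose 𝒜 hB, Finset.sum_mul_sum]
  rw [DirectSum.decompose_sum, DFinsupp.finsetSum_apply, AddSubmonoidClass.coe_finsetSum]
  refine Finset.sum_congr rfl fun i _ => ?_
  rw [DirectSum.decompose_sum, DFinsupp.finsetSum_apply, AddSubmonoidClass.coe_finsetSum]
  refine Finset.sum_congr rfl fun j _ => ?_
  have hm : (DirectSum.decompose 𝒜 f i * DirectSum.decompose 𝒜 g j : R) ∈ 𝒜 (i + j) :=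
    SetLike.mul_mem_graded (SetLike.coe_mem _) (SetLike.coe_mem _)
  split_ifs with h
  · rw [← h, DirectSum.decompose_of_mem_same 𝒜 hm]
  · rw [DirectSum.decompose_of_mem_ne 𝒜 hm h]

variable (K : Type*) [Field K] [Algebra R K]

variable {K} in
theorem content_le_iff {f : R} {N : Submodule R K} :
    content 𝒜 K f ≤ N ↔ ∀ i, algebraMap R K (DirectSum.decompose 𝒜 f i) ∈ N := by
  rw [content, Submodule.span_le, Set.range_subset_iff]
  rfl

theorem decompose_mem_content (f : R) (i : Γ) :
    algebraMap R K (DirectSum.decompose 𝒜 f i) ∈ content 𝒜 K f :=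
  Submodule.subset_span ⟨i, rfl⟩

theorem mem_content_self (f : R) : algebraMap R K f ∈ content 𝒜 K f := by
  obtain ⟨A, hA⟩ := exists_finset_decompose 𝒜 f
  rw [← sum_decompose 𝒜 hA, map_sum, sum_decompose 𝒜 hA]
  exact sum_mem fun i _ => decompose_mem_content 𝒜 K f i

theorem content_fg (f : R) : (content 𝒜 K f).FG := by
  classical
  obtain ⟨A, hA⟩ := exists_finset_decompose 𝒜 f
  refine ⟨A.image fun i => algebraMap R K (DirectSum.decompose 𝒜 f i), le_antisymm ?_ ?_⟩
  · rw [Submodule.span_le]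
    intro x hx
    obtain ⟨i, -, rfl⟩ := Finset.mem_image.1 hx
    exact decompose_mem_content 𝒜 K f i
  · rw [content_le_iff]
    intro i
    by_cases hi : i ∈ A
    · exact Submodule.subset_span (Finset.mem_image_of_mem _ hi)
    · rw [hA i hi, map_zero]
      exact zero_mem _

@[simp]
theorem content_zero : content 𝒜 K (0 : R) = ⊥ := by
  rw [eq_bot_iff, content_le_iff]
  simp

@[simp]
theorem content_neg (f : R) : content 𝒜 K (-f) = content 𝒜 K f := by
  have h : ∀ f : R, content 𝒜 K (-f) ≤ content 𝒜 K f := fun f => by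
    rw [content_le_iff]
    intro i
    have hi : (DirectSum.decompose 𝒜 (-f) i : R) = -(DirectSum.decompose 𝒜 f i : R) :=
      map_neg (GradedRing.proj 𝒜 i) f
    rw [hi, map_neg]
    exact neg_mem (decompose_mem_content 𝒜 K f i)
  exact le_antisymm (h f) (by simpa using h (-f))

theorem content_add_le (f g : R) : content 𝒜 K (f + g) ≤ content 𝒜 K f ⊔ content 𝒜 K g := by
  rw [content_le_iff]
  intro i
  rw [DirectSum.decompose_add, DirectSum.add_apply, AddMemClass.coe_add, map_add]
  exact Submodule.add_mem_sup (decompose_mem_content 𝒜 K f i) (decompose_mem_content 𝒜 K g i)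

theorem content_sub_le (f g : R) : content 𝒜 K (f - g) ≤ content 𝒜 K f ⊔ content 𝒜 K g := by
  simpa [sub_eq_add_neg] using content_add_le 𝒜 K f (-g)

theorem content_mul_le (f g : R) : content 𝒜 K (f * g) ≤ content 𝒜 K f * content 𝒜 K g := by
  obtain ⟨A, hA⟩ := exists_finset_decompose 𝒜 f
  obtain ⟨B, hB⟩ := exists_finset_decompose 𝒜 g
  rw [content_le_iff]
  intro k
  rw [decompose_mul_eq_sum 𝒜 hA hB, map_sum]
  refine sum_mem fun i _ => ?_
  rw [map_sum]
  refine sum_mem fun j _ => ?_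
  split_ifs
  · rw [map_mul]
    exact Submodule.mul_mem_mul (decompose_mem_content 𝒜 K f i) (decompose_mem_content 𝒜 K g j)
  · simp

variable {𝒜} in
theorem content_of_homogeneous {a : R} (ha : SetLike.IsHomogeneousElem 𝒜 a) :
    content 𝒜 K a = R ∙ algebraMap R K a := by
  obtain ⟨i, hi⟩ := ha
  refine le_antisymm ?_ ?_
  · rw [content_le_iff]
    intro j
    by_cases hij : i = j
    · subst hij
      rw [DirectSum.decompose_of_mem_same 𝒜 hi]
      exact Submodule.mem_span_singleton_self _
    · rw [DirectSum.decompose_of_mem_ne 𝒜 hi hij]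
      simp
  · rw [Submodule.span_singleton_le_iff_mem]
    exact mem_content_self 𝒜 K a

variable {𝒜} in
theorem content_homogeneous_mul {a : R} (ha : SetLike.IsHomogeneousElem 𝒜 a) (f : R) :
    content 𝒜 K (a * f) = (R ∙ algebraMap R K a) * content 𝒜 K f := by
  refine le_antisymm ((content_mul_le 𝒜 K a f).trans_eq
    (by rw [content_of_homogeneous K ha])) ?_
  rw [content, Submodule.span_mul_span, Submodule.span_le]
  rintro _ ⟨_, rfl, _, ⟨i, rfl⟩, rfl⟩
  obtain ⟨d, hd⟩ := ha
  have := decompose_mem_content 𝒜 K (a * f) (d + i)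
  rwa [DirectSum.coe_decompose_mul_add_of_left_mem 𝒜 hd, map_mul] at this

theorem content_one : content 𝒜 K (1 : R) = 1 := by
  rw [content_of_homogeneous K ⟨0, SetLike.GradedOne.one_mem⟩, map_one, Submodule.one_eq_span]

variable [IsAddTorsionFree Γ]

/-- The **Dedekind–Mertens lemma** for rings graded by a torsionless grading monoid. -/
theorem content_pow_mul_content_le {f g : R} {A B : Finset Γ}
    (hA : ∀ i ∉ A, (DirectSum.decompose 𝒜 f i : R) = 0)
    (hB : ∀ i ∉ B, (DirectSum.decompose 𝒜 g i : R) = 0) :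
    content 𝒜 K f ^ (B.card + 1) * content 𝒜 K g ≤
      content 𝒜 K f ^ B.card * content 𝒜 K (f * g) := by
  -- The exponent is the number of allowed degrees of g, one more than in the sharp form, so that
  -- the base case is g = 0.
  induction hn : B.card generalizing f g A B with
  | zero =>
    obtain rfl := Finset.card_eq_zero.1 hn
    have hg : g = 0 := by simpa using (sum_decompose 𝒜 hB).symm
    simp [hg]
  | succ k ihB =>
    induction hm : A.card generalizing f A with
    | zero =>
      obtain rfl := Finset.card_eq_zero.1 hm
      have hf : f = 0 := by simpa using (sum_decompose 𝒜 hA).symm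
      simp [hf]
    | succ m ihA =>
      have := uniqueSums_of_isAddTorsionFree Γ
      -- The pair (r, s) plays the role of the leading terms: f_r g_s is a full component of fg. The
      -- outer induction drops g_s, the inner one f_r.
      obtain ⟨r, hr, s, hs, hrs⟩ := UniqueSums.uniqueAdd_of_nonempty (A := A) (B := B)
        (Finset.card_pos.1 (by omega)) (Finset.card_pos.1 (by omega))
      have hcomp : (DirectSum.decompose 𝒜 (f * g) (r + s) : R) =
          DirectSum.decompose 𝒜 f r * DirectSum.decompose 𝒜 g s := by
        rw [decompose_mul_eq_sum 𝒜 hA hB, Finset.sum_eq_single_of_mem r hr,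
          Finset.sum_eq_single_of_mem s hs]
        · simp
        · exact fun j hj hjs => if_neg fun e => hjs (hrs hr hj e).2
        · exact fun i hi hir => Finset.sum_eq_zero fun j hj => if_neg fun e => hir (hrs hi hj e).1
      have herase : ∀ {x : R} {C : Finset Γ} (t : Γ),
          (∀ i ∉ C, (DirectSum.decompose 𝒜 x i : R) = 0) →
          ∀ i ∉ C.erase t, (DirectSum.decompose 𝒜 (x - DirectSum.decompose 𝒜 x t) i : R) = 0 := by
        intro x C t hC i hi
        rw [DirectSum.decompose_sub, DirectSum.sub_apply, AddSubgroupClass.coe_sub]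
        by_cases hti : t = i
        · subst hti
          rw [DirectSum.decompose_of_mem_same 𝒜 (SetLike.coe_mem _), sub_self]
        · rw [DirectSum.decompose_of_mem_ne 𝒜 (SetLike.coe_mem _) hti, sub_zero]
          exact hC i fun h => hi (Finset.mem_erase.2 ⟨fun h => hti h.symm, h⟩)
      set fr : R := ↑(DirectSum.decompose 𝒜 f r) with hfr
      set gs : R := ↑(DirectSum.decompose 𝒜 g s) with hgs
      have hfrA : SetLike.IsHomogeneousElem 𝒜 fr := ⟨r, SetLike.coe_mem _⟩
      have hgsA : SetLike.IsHomogeneousElem 𝒜 gs := ⟨s, SetLike.coe_mem _⟩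
      have ih₁ := ihB hA (herase s hB) (by rw [Finset.card_erase_of_mem hs, hn]; rfl)
      have ih₂ := ihA (herase r hA) (by rw [Finset.card_erase_of_mem hr, hm]; rfl)
      have hfrle : content 𝒜 K fr ≤ content 𝒜 K f := by
        rw [content_of_homogeneous K hfrA, Submodule.span_singleton_le_iff_mem]
        exact decompose_mem_content 𝒜 K f r
      refine pow_mul_le_of_le_add (a := content 𝒜 K fr) (b := content 𝒜 K gs) ?_ ?_ ?_ hfrle ?_ ?_ ?_
        ih₁ ih₂
      · rw [content_of_homogeneous K hfrA, content_of_homogeneous K hgsA,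
          Submodule.span_mul_span, Set.singleton_mul_singleton,
          Submodule.span_singleton_le_iff_mem, ← map_mul, ← hcomp]
        exact decompose_mem_content 𝒜 K _ _
      · simpa using content_add_le 𝒜 K (f - fr) fr
      · exact (content_sub_le 𝒜 K f fr).trans (sup_le le_rfl hfrle)
      · simpa using content_add_le 𝒜 K (g - gs) gs
      · rw [mul_sub]
        exact (content_sub_le 𝒜 K _ _).trans (sup_le_sup le_rfl (content_mul_le 𝒜 K f gs))
      · rw [sub_mul]
        exact (content_sub_le 𝒜 K _ _).trans (sup_le_sup le_rfl (content_mul_le 𝒜 K fr g))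

end GradedKronecker

/-! ### Products and cancellation under ⋆_a. -/

namespace SemistarOperation

variable {R K : Type*} [CommRing R] [Field K] [Algebra R K]

theorem mul_star_le (star : SemistarOperation R K) (E F : Submodule R K) :
    E * star F ≤ star (E * F) := by
  rw [mul_comm, mul_comm E]
  exact star.star_mul_le F E

theorem star_mul_star_le (star : SemistarOperation R K) (E F : Submodule R K) :
    star E * star F ≤ star (E * F) := by
  refine (star.star_mul_le _ _).trans ?_
  rw [← star.idem (E * F)]
  exact star.mono (star.mul_star_le _ _)

theorem star_span_singleton_mul (star : SemistarOperation R K) {x : K} (hx : x ≠ 0)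
    (E : Submodule R K) : star ((R ∙ x) * E) = (R ∙ x) * star E := by
  rw [Submodule.span_singleton_mul, Submodule.span_singleton_mul, star.map_smul x hx]

theorem star_le_eab (star : SemistarOperation R K) {E : Submodule R K} (hE : E.FG) :
    star E ≤ star.eab E := by
  intro x hx
  refine ⟨E, le_rfl, hE, R ∙ (1 : K), Submodule.fg_span_singleton _, by simp, ?_⟩
  rw [mem_div_star_iff]
  intro y hy
  exact star.star_mul_le _ _ (Submodule.mul_mem_mul hx hy)

/-- Finitely generated submodules can be cancelled under the e.a.b. operation. -/
theorem le_eab_of_mul_le (star : SemistarOperation R K) {F G H : Submodule R K} (hF : F.FG)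
    (hG : G.FG) (hH : H.FG) (hH0 : H ≠ ⊥) (h : F * H ≤ star.eab (G * H)) : F ≤ star.eab G := by
  obtain ⟨E, hE, -, L, hL, hL0, hEL⟩ := star.exists_common (hF.mul hH) h
  intro x hx
  -- L witnesses FH ⊆ (GH)^{⋆_a}, so HL witnesses F ⊆ G^{⋆_a}.
  refine ⟨G, le_rfl, hG, H * L, hH.mul hL, mul_ne_bot hH0 hL0, ?_⟩
  rw [← Submodule.span_singleton_le_iff_mem, Submodule.le_div_iff_mul_le]
  have h1 : (R ∙ x) * (H * L) ≤ star (G * (H * L)) := by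
    rw [← mul_assoc, ← mul_assoc]
    calc (R ∙ x) * H * L ≤ F * H * L := by
          gcongr
          rwa [Submodule.span_singleton_le_iff_mem]
      _ ≤ F * H * star L := mul_le_mul_right (star.le_self L) _
      _ ≤ star (E * L) := Submodule.le_div_iff_mul_le.1 hEL
      _ ≤ star (G * H * L) := star.mono (mul_le_mul_left hE L)
  calc (R ∙ x) * star (H * L) ≤ star ((R ∙ x) * (H * L)) := star.mul_star_le _ _
    _ ≤ star (star (G * (H * L))) := star.mono h1
    _ = _ := star.idem _

end SemistarOperation

/-! ### Realizing ideals as contents; homogeneous submodules. -/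

namespace GradedKronecker

variable {Γ R : Type*} [AddCancelCommMonoid Γ] [DecidableEq Γ] [CommRing R]
  (𝒜 : Γ → AddSubgroup R) [GradedRing 𝒜] (K : Type*) [Field K] [Algebra R K]

theorem content_le_one (f : R) : content 𝒜 K f ≤ 1 := by
  rw [content_le_iff]
  exact fun i => Submodule.mem_one.2 ⟨_, rfl⟩

theorem content_eq_coeSubmodule (f : R) :
    ∃ I : Ideal R, I.IsHomogeneous 𝒜 ∧ content 𝒜 K f = IsLocalization.coeSubmodule K I := by
  refine ⟨Ideal.span (Set.range fun i => (DirectSum.decompose 𝒜 f i : R)),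
    Ideal.homogeneous_span 𝒜 _ ?_, ?_⟩
  · rintro _ ⟨i, rfl⟩
    exact ⟨i, SetLike.coe_mem _⟩
  · rw [IsLocalization.coeSubmodule_span, ← Set.range_comp]
    rfl

theorem content_mul_smul_le (r : R) {x : R} {N : Submodule R K} (h : content 𝒜 K x ≤ N) :
    content 𝒜 K (r * x) ≤ N :=
  calc content 𝒜 K (r * x) ≤ content 𝒜 K r * content 𝒜 K x := content_mul_le 𝒜 K r x
    _ ≤ 1 * N := mul_le_mul' (content_le_one 𝒜 K r) h
    _ = N := one_mul N

section mixing

variable [IsAddTorsionFree Γ]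

/-- A homogeneous unit of nonzero degree moves the components of `g` away from those of `f`. -/
theorem exists_content_add_pow_mul_eq_sup {u : R} {α : Γ} (hu : IsUnit u) (huα : u ∈ 𝒜 α)
    (hα : α ≠ 0) (f g : R) :
    ∃ n : ℕ, content 𝒜 K (f + u ^ n * g) = content 𝒜 K f ⊔ content 𝒜 K g := by
  classical
  obtain ⟨A, hA⟩ := exists_finset_decompose 𝒜 f
  obtain ⟨B, hB⟩ := exists_finset_decompose 𝒜 g
  have hinj : Function.Injective fun n : ℕ => n • α := by
    intro m n hmn
    wlog h : m ≤ n generalizing m n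
    · exact (this hmn.symm (le_of_not_ge h)).symm
    obtain ⟨d, rfl⟩ := Nat.exists_eq_add_of_le h
    have h0 : d • α = 0 := by simpa [add_nsmul] using hmn
    have := (nsmul_eq_zero_iff_left hα).1 h0
    omega
  -- The multiples of α are distinct, so each pair (i, j) excludes at most one n.
  obtain ⟨n, hn⟩ : ∃ n : ℕ, ∀ i ∈ A, ∀ j ∈ B, n • α + j ≠ i := by
    let T : Set ℕ := ⋃ i ∈ A, ⋃ j ∈ B, {n | n • α + j = i}
    have hT : T.Finite := by
      refine A.finite_toSet.biUnion fun i _ => B.finite_toSet.biUnion fun j _ => ?_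
      refine Set.Subsingleton.finite fun a ha b hb => hinj ?_
      exact add_right_cancel (ha.trans hb.symm)
    obtain ⟨n, hn⟩ := hT.exists_notMem
    refine ⟨n, fun i hi j hj h => hn ?_⟩
    simp only [T, Set.mem_iUnion]
    exact ⟨i, hi, j, hj, h⟩
  have hunA : u ^ n ∈ 𝒜 (n • α) := SetLike.pow_mem_graded n huα
  have hadd : ∀ k, (DirectSum.decompose 𝒜 (f + u ^ n * g) k : R) =
      DirectSum.decompose 𝒜 f k + DirectSum.decompose 𝒜 (u ^ n * g) k := fun k => by
    rw [DirectSum.decompose_add, DirectSum.add_apply, AddMemClass.coe_add]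
  refine ⟨n, le_antisymm ?_ (sup_le ?_ ?_)⟩
  · exact (content_add_le 𝒜 K _ _).trans (sup_le_sup le_rfl (content_mul_smul_le 𝒜 K _ le_rfl))
  · rw [content_le_iff]
    intro i
    by_cases hi : i ∈ A
    · have h0 : (DirectSum.decompose 𝒜 (u ^ n * g) i : R) = 0 := by
        have hun : ∀ k ∉ ({n • α} : Finset Γ), (DirectSum.decompose 𝒜 (u ^ n) k : R) = 0 :=
          fun k hk => DirectSum.decompose_of_mem_ne 𝒜 hunA
            fun e => hk (Finset.mem_singleton.2 e.symm)
        rw [decompose_mul_eq_sum 𝒜 hun hB, Finset.sum_singleton]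
        exact Finset.sum_eq_zero fun j hj => if_neg (hn i hi j hj)
      have := decompose_mem_content 𝒜 K (f + u ^ n * g) i
      rwa [hadd, h0, add_zero] at this
    · rw [hA i hi, map_zero]
      exact zero_mem _
  · rw [content_le_iff]
    intro j
    by_cases hj : j ∈ B
    · have h0 : (DirectSum.decompose 𝒜 f (n • α + j) : R) = 0 := hA _ fun h => hn _ h j hj rfl
      have h1 := decompose_mem_content 𝒜 K (f + u ^ n * g) (n • α + j)
      rw [hadd, h0, zero_add, DirectSum.coe_decompose_mul_add_of_left_mem 𝒜 hunA] at h1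
      obtain ⟨v, hv⟩ := (hu.pow n).exists_left_inv
      have h2 := Submodule.smul_mem _ v h1
      rwa [Algebra.smul_def, ← map_mul, ← mul_assoc, hv, one_mul] at h2
    · rw [hB j hj, map_zero]
      exact zero_mem _

theorem exists_content_eq_finset_sup {u : R} {α : Γ} (hu : IsUnit u) (huα : u ∈ 𝒜 α)
    (hα : α ≠ 0) (S : Finset R) : ∃ h : R, content 𝒜 K h = S.sup (content 𝒜 K) := by
  classical
  induction S using Finset.induction_on with
  | empty => exact ⟨0, by simp⟩
  | insert a S _ ih =>
    obtain ⟨h, hh⟩ := ih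
    obtain ⟨n, hn⟩ := exists_content_add_pow_mul_eq_sup 𝒜 K hu huα hα a h
    exact ⟨a + u ^ n * h, by rw [hn, hh, Finset.sup_insert]⟩

theorem exists_content_eq_coeSubmodule {u : R} {α : Γ} (hu : IsUnit u) (huα : u ∈ 𝒜 α)
    (hα : α ≠ 0) {I : Ideal R} (hI : I.FG) (hI' : I.IsHomogeneous 𝒜) :
    ∃ f : R, content 𝒜 K f = IsLocalization.coeSubmodule K I := by
  obtain ⟨S, rfl⟩ := hI
  obtain ⟨f, hf⟩ := exists_content_eq_finset_sup 𝒜 K hu huα hα S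
  refine ⟨f, hf.trans (le_antisymm (Finset.sup_le fun x hx => ?_) ?_)⟩
  · rw [content_le_iff]
    exact fun i => ⟨_, hI' i (Submodule.subset_span hx), rfl⟩
  · rw [IsLocalization.coeSubmodule_span, Submodule.span_le]
    rintro _ ⟨x, hx, rfl⟩
    exact Finset.le_sup (f := content 𝒜 K) hx (mem_content_self 𝒜 K x)

end mixing

section preservesHomogeneous

variable [Nontrivial R] {𝒜 K}
variable {star : SemistarOperation R K}

theorem PreservesHomogeneous.coeSubmodule (hstar : PreservesHomogeneous 𝒜 star) {I : Ideal R}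
    (hI : I.IsHomogeneous 𝒜) : IsHomogeneousSubmodule 𝒜 (star (IsLocalization.coeSubmodule K I)) := by
  -- The hypothesis on ⋆ covers only nonzero modules; the zero ideal relies on 0^⋆ = 0.
  by_cases h0 : IsLocalization.coeSubmodule K I = ⊥
  · rw [h0, star.map_bot, IsHomogeneousSubmodule, eq_bot_iff, Submodule.span_le]
    exact Set.inter_subset_left
  · exact hstar _ h0 ⟨1, ⟨0, SetLike.GradedOne.one_mem⟩, one_ne_zero, I, hI, by simp⟩

theorem PreservesHomogeneous.content_mul (hstar : PreservesHomogeneous 𝒜 star) (f g : R) :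
    IsHomogeneousSubmodule 𝒜 (star (content 𝒜 K f * content 𝒜 K g)) := by
  obtain ⟨I, hI, h1⟩ := content_eq_coeSubmodule 𝒜 K f
  obtain ⟨J, hJ, h2⟩ := content_eq_coeSubmodule 𝒜 K g
  rw [h1, h2, ← IsLocalization.coeSubmodule_mul]
  exact hstar.coeSubmodule (hI.mul hJ)

end preservesHomogeneous

variable [IsFractionRing R K]

theorem content_ne_bot {f : R} (hf : f ≠ 0) : content 𝒜 K f ≠ ⊥ :=
  (Submodule.ne_bot_iff _).2 ⟨_, mem_content_self 𝒜 K f, by simpa using hf⟩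

theorem content_mul_homogeneous_inv {a s : R} (hs : SetLike.IsHomogeneousElem 𝒜 s) (hs0 : s ≠ 0) :
    (R ∙ (algebraMap R K s)⁻¹) * content 𝒜 K (s * a) = content 𝒜 K a := by
  rw [content_homogeneous_mul K hs, ← mul_assoc, Submodule.span_mul_span,
    Set.singleton_mul_singleton, inv_mul_cancel₀ (by simpa using hs0), ← Submodule.one_eq_span,
    one_mul]

variable [IsDomain R]

variable {K} in
theorem exists_span_mul_eq_span_image {H : Submodule R K} (hH : H.FG) :
    ∃ d : R, d ≠ 0 ∧ ∃ S : Finset R,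
      (R ∙ algebraMap R K d) * H = Submodule.span R (algebraMap R K '' S) := by
  classical
  obtain ⟨T, rfl⟩ := hH
  obtain ⟨⟨d, hd⟩, hdT⟩ := IsLocalization.exist_integer_multiples_of_finset (nonZeroDivisors R) T
  choose! φ hφ using hdT
  refine ⟨d, nonZeroDivisors.ne_zero hd, T.image φ, ?_⟩
  rw [Submodule.span_mul_span, Set.singleton_mul, Finset.coe_image, Set.image_image]
  congr 1
  refine Set.image_congr fun x hx => ?_
  rw [hφ x hx, Algebra.smul_def]

section homogeneousSubmodule

variable {𝒜 K}
variable {M : Submodule R K}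

/-- The last condition says that the components a_i / s of y lie in M. It is the invariant that
survives sums over a common denominator. -/
theorem exists_fraction_of_mem (hM : IsHomogeneousSubmodule 𝒜 M) {y : K} (hy : y ∈ M) :
    ∃ a s : R, SetLike.IsHomogeneousElem 𝒜 s ∧ s ≠ 0 ∧ y = algebraMap R K a / algebraMap R K s ∧
      (R ∙ (algebraMap R K s)⁻¹) * content 𝒜 K a ≤ M := by
  rw [← hM] at hy
  induction hy using Submodule.span_induction with
  | mem y hy =>
    obtain ⟨hyM, a, s, ha, hs, hs0, rfl⟩ := hy
    refine ⟨a, s, hs, hs0, rfl, ?_⟩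
    rw [content_of_homogeneous K ha, Submodule.span_mul_span, Set.singleton_mul_singleton,
      Submodule.span_singleton_le_iff_mem, mul_comm, ← div_eq_mul_inv]
    exact hyM
  | zero => exact ⟨0, 1, ⟨0, SetLike.GradedOne.one_mem⟩, one_ne_zero, by simp, by simp⟩
  | add x y _ _ ihx ihy =>
    obtain ⟨a, s, hs, hs0, rfl, hsM⟩ := ihx
    obtain ⟨b, t, ht, ht0, rfl, htM⟩ := ihy
    have hsK : algebraMap R K s ≠ 0 := by simpa using hs0
    have htK : algebraMap R K t ≠ 0 := by simpa using ht0
    refine ⟨t * a + s * b, s * t, ?_, mul_ne_zero hs0 ht0, ?_, ?_⟩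
    · obtain ⟨i, hi⟩ := hs
      obtain ⟨j, hj⟩ := ht
      exact ⟨i + j, SetLike.mul_mem_graded hi hj⟩
    · simp only [map_add, map_mul]
      field_simp
    · have h1 : (R ∙ (algebraMap R K (s * t))⁻¹) =
          (R ∙ (algebraMap R K s)⁻¹) * (R ∙ (algebraMap R K t)⁻¹) := by
        rw [Submodule.span_mul_span, Set.singleton_mul_singleton, map_mul, mul_inv]
      calc _ ≤ (R ∙ (algebraMap R K (s * t))⁻¹) *
            (content 𝒜 K (t * a) ⊔ content 𝒜 K (s * b)) :=
            mul_le_mul_right (content_add_le 𝒜 K _ _) _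
        _ = (R ∙ (algebraMap R K s)⁻¹) * ((R ∙ (algebraMap R K t)⁻¹) * content 𝒜 K (t * a)) ⊔
            (R ∙ (algebraMap R K t)⁻¹) * ((R ∙ (algebraMap R K s)⁻¹) * content 𝒜 K (s * b)) := by
            rw [h1, Submodule.mul_sup, mul_assoc]
            congr 1
            rw [mul_left_comm, mul_assoc]
        _ ≤ M := by
            rw [content_mul_homogeneous_inv 𝒜 K ht ht0, content_mul_homogeneous_inv 𝒜 K hs hs0]
            exact sup_le hsM htM
  | smul r x _ ih =>
    obtain ⟨a, s, hs, hs0, rfl, hsM⟩ := ih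
    refine ⟨r * a, s, hs, hs0, by rw [Algebra.smul_def, map_mul, mul_div_assoc], ?_⟩
    exact (mul_le_mul_right (content_mul_smul_le 𝒜 K r le_rfl) _).trans hsM

/-- A homogeneous submodule contains the homogeneous components of its elements. -/
theorem content_le_of_mem (hM : IsHomogeneousSubmodule 𝒜 M) {f : R} (hf : algebraMap R K f ∈ M) :
    content 𝒜 K f ≤ M := by
  obtain ⟨a, s, hs, hs0, h, hsM⟩ := exists_fraction_of_mem hM hf
  rw [eq_div_iff (by simpa using hs0), ← map_mul] at h
  rwa [← IsFractionRing.injective R K h, mul_comm f s, content_mul_homogeneous_inv 𝒜 K hs hs0] at hsM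

theorem mem_homogeneousQuotientField_of_mem (hM : IsHomogeneousSubmodule 𝒜 M) {x : K}
    (hx : x ∈ M) : x ∈ homogeneousQuotientField 𝒜 K := by
  obtain ⟨a, s, hs, hs0, h, -⟩ := exists_fraction_of_mem hM hx
  exact ⟨a, s, hs, hs0, h⟩

end homogeneousSubmodule

end GradedKronecker

/-! ### The Kronecker function ring. -/

namespace GradedKronecker

variable {Γ R K : Type*} [AddCancelCommMonoid Γ] [IsAddTorsionFree Γ] [DecidableEq Γ] [CommRing R]
  (𝒜 : Γ → AddSubgroup R) [GradedRing 𝒜] [Field K] [Algebra R K] [IsFractionRing R K]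
  {star : SemistarOperation R K}

/-- A Gauss lemma up to ⋆_a: Dedekind–Mertens, then cancellation of the power of C(f). -/
theorem content_mul_content_le_eab (star : SemistarOperation R K) (f g : R) :
    content 𝒜 K f * content 𝒜 K g ≤ star.eab (content 𝒜 K (f * g)) := by
  by_cases hf : f = 0
  · simp [hf]
  obtain ⟨A, hA⟩ := exists_finset_decompose 𝒜 f
  obtain ⟨B, hB⟩ := exists_finset_decompose 𝒜 g
  refine star.le_eab_of_mul_le ((content_fg 𝒜 K f).mul (content_fg 𝒜 K g)) (content_fg 𝒜 K _)
    ((content_fg 𝒜 K f).pow B.card) (pow_ne_zero _ (content_ne_bot 𝒜 K hf)) ?_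
  have h := content_pow_mul_content_le 𝒜 K hA hB
  calc content 𝒜 K f * content 𝒜 K g * content 𝒜 K f ^ B.card
      = content 𝒜 K f ^ (B.card + 1) * content 𝒜 K g := by ring
    _ ≤ content 𝒜 K f ^ B.card * content 𝒜 K (f * g) := h
    _ = content 𝒜 K (f * g) * content 𝒜 K f ^ B.card := mul_comm _ _
    _ ≤ _ := star.eab.le_self _

variable {𝒜} [IsDomain R]

/-- After scaling into `R`, the coefficients of the generators of a finitely generated module are
collected in one content. -/
theorem exists_span_mul_le_content (hunit : ∃ (u : R) (α : Γ), IsUnit u ∧ u ∈ 𝒜 α ∧ α ≠ 0)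
    {H : Submodule R K} (hH : H.FG) (hH0 : H ≠ ⊥) :
    ∃ d h : R, d ≠ 0 ∧ h ≠ 0 ∧ (R ∙ algebraMap R K d) * H ≤ content 𝒜 K h ∧ ∃ S : Finset R,
      content 𝒜 K h = S.sup (content 𝒜 K) ∧
      ∀ x ∈ S, algebraMap R K x ∈ (R ∙ algebraMap R K d) * H := by
  obtain ⟨u, α, hu, huα, hα⟩ := hunit
  obtain ⟨d, hd, S, hS⟩ := exists_span_mul_eq_span_image hH
  obtain ⟨h, hh⟩ := exists_content_eq_finset_sup 𝒜 K hu huα hα S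
  have hle : (R ∙ algebraMap R K d) * H ≤ content 𝒜 K h := by
    rw [hS, Submodule.span_le]
    rintro _ ⟨x, hx, rfl⟩
    rw [hh]
    exact Finset.le_sup (f := content 𝒜 K) hx (mem_content_self 𝒜 K x)
  refine ⟨d, h, hd, ?_, hle, S, hh, fun x hx => hS ▸ Submodule.subset_span ⟨x, hx, rfl⟩⟩
  rintro rfl
  rw [content_zero] at hle
  exact SemistarOperation.mul_ne_bot (G := R ∙ algebraMap R K d) (by simpa using hd) hH0
    (le_bot_iff.1 hle)

/-- Replaces an arbitrary test module H by a content. For a component f_i of f and a generator x of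
the scaled H, f_i x lies in a homogeneous module, which then contains C(f_i x) = f_i C(x); the C(x)
add up to C(k). -/
theorem exists_content_mul_content_le (hunit : ∃ (u : R) (α : Γ), IsUnit u ∧ u ∈ 𝒜 α ∧ α ≠ 0)
    (hstar : PreservesHomogeneous 𝒜 star) {f g : R} {H : Submodule R K} (hH : H.FG) (hH0 : H ≠ ⊥)
    (h : content 𝒜 K f * H ≤ star (content 𝒜 K g * H)) :
    ∃ h : R, h ≠ 0 ∧
      content 𝒜 K f * content 𝒜 K h ≤ star (content 𝒜 K g * content 𝒜 K h) := by
  obtain ⟨d, k, hd, hk, hdk, S, hS, hSd⟩ := exists_span_mul_le_content hunit hH hH0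
  have h1 : content 𝒜 K f * ((R ∙ algebraMap R K d) * H) ≤
      star (content 𝒜 K g * content 𝒜 K k) := by
    calc _ = (R ∙ algebraMap R K d) * (content 𝒜 K f * H) := mul_left_comm _ _ _
      _ ≤ (R ∙ algebraMap R K d) * star (content 𝒜 K g * H) := mul_le_mul_right h _
      _ ≤ star ((R ∙ algebraMap R K d) * (content 𝒜 K g * H)) := star.mul_star_le _ _
      _ ≤ _ := star.mono (by rw [mul_left_comm]; exact mul_le_mul_right hdk _)
  refine ⟨k, hk, ?_⟩
  rw [mul_comm, ← Submodule.le_div_iff_mul_le, hS]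
  refine Finset.sup_le fun x hx => ?_
  rw [Submodule.le_div_iff_mul_le, mul_comm, ← Submodule.le_div_iff_mul_le, content_le_iff]
  intro i
  rw [← Submodule.span_singleton_le_iff_mem, Submodule.le_div_iff_mul_le,
    ← content_homogeneous_mul K ⟨i, SetLike.coe_mem _⟩]
  refine content_le_of_mem (hS ▸ hstar.content_mul g k) ?_
  rw [map_mul, ← hS]
  exact h1 (Submodule.mul_mem_mul (decompose_mem_content 𝒜 K f i) (hSd x hx))

/-- Here p need not be homogeneous, so C(px) is compared with C(p)C(x) by the Gauss lemma; summing
over the generators x gives C(p)C(k) ⊆ (C(g)C(k))^{⋆_a}, and C(k) cancels. -/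
theorem content_le_eab_of_mem (hunit : ∃ (u : R) (α : Γ), IsUnit u ∧ u ∈ 𝒜 α ∧ α ≠ 0)
    (hstar : PreservesHomogeneous 𝒜 star) {p g : R}
    (hp : algebraMap R K p ∈ star.eab (content 𝒜 K g)) :
    content 𝒜 K p ≤ star.eab (content 𝒜 K g) := by
  obtain ⟨F, hF, -, H, hH, hH0, hpH⟩ := hp
  obtain ⟨d, k, hd, hk, hdk, S, hS, hSd⟩ := exists_span_mul_le_content hunit hH hH0
  have h1 : (R ∙ algebraMap R K p) * ((R ∙ algebraMap R K d) * H) ≤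
      star (content 𝒜 K g * content 𝒜 K k) := by
    rw [← Submodule.span_singleton_le_iff_mem, Submodule.le_div_iff_mul_le] at hpH
    calc _ = (R ∙ algebraMap R K d) * ((R ∙ algebraMap R K p) * H) := mul_left_comm _ _ _
      _ ≤ (R ∙ algebraMap R K d) * star (F * H) :=
        mul_le_mul_right ((mul_le_mul_right (star.le_self H) _).trans hpH) _
      _ ≤ star ((R ∙ algebraMap R K d) * (F * H)) := star.mul_star_le _ _
      _ ≤ _ := star.mono (by rw [mul_left_comm]; exact mul_le_mul' hF hdk)
  have hfg : (content 𝒜 K g * content 𝒜 K k).FG := (content_fg 𝒜 K g).mul (content_fg 𝒜 K k)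
  refine star.le_eab_of_mul_le (content_fg 𝒜 K p) (content_fg 𝒜 K g) (content_fg 𝒜 K k)
    (content_ne_bot 𝒜 K hk) ?_
  rw [mul_comm, ← Submodule.le_div_iff_mul_le, hS]
  refine Finset.sup_le fun x hx => ?_
  rw [Submodule.le_div_iff_mul_le, mul_comm, ← hS]
  have h2 : content 𝒜 K (p * x) ≤ star (content 𝒜 K g * content 𝒜 K k) := by
    refine content_le_of_mem (hstar.content_mul g k) (h1 ?_)
    rw [map_mul]
    exact Submodule.mul_mem_mul (Submodule.mem_span_singleton_self _) (hSd x hx)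
  calc content 𝒜 K p * content 𝒜 K x ≤ star.eab (content 𝒜 K (p * x)) :=
        content_mul_content_le_eab 𝒜 star p x
    _ ≤ star.eab (star.eab (content 𝒜 K g * content 𝒜 K k)) :=
        star.eab.mono (h2.trans (star.star_le_eab hfg))
    _ = _ := star.eab.idem _

theorem content_le_eab_iff (hunit : ∃ (u : R) (α : Γ), IsUnit u ∧ u ∈ 𝒜 α ∧ α ≠ 0)
    (hstar : PreservesHomogeneous 𝒜 star) (f g : R) :
    (∃ h : R, h ≠ 0 ∧
      content 𝒜 K f * content 𝒜 K h ≤ star (content 𝒜 K g * content 𝒜 K h)) ↔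
      content 𝒜 K f ≤ star.eab (content 𝒜 K g) := by
  constructor
  · rintro ⟨h, hh, hle⟩
    exact star.le_eab_of_mul_le (content_fg 𝒜 K f) (content_fg 𝒜 K g) (content_fg 𝒜 K h)
      (content_ne_bot 𝒜 K hh)
      (hle.trans (star.star_le_eab ((content_fg 𝒜 K g).mul (content_fg 𝒜 K h))))
  · intro h
    obtain ⟨E, hE, -, L, hL, hL0, hEL⟩ := star.exists_common (content_fg 𝒜 K f) h
    refine exists_content_mul_content_le hunit hstar hL hL0 ?_
    rw [Submodule.le_div_iff_mul_le] at hEL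
    exact (mul_le_mul_right (star.le_self L) _).trans
      (hEL.trans (star.mono (mul_le_mul_left hE L)))

theorem mem_kr_iff (hunit : ∃ (u : R) (α : Γ), IsUnit u ∧ u ∈ 𝒜 α ∧ α ≠ 0)
    (hstar : PreservesHomogeneous 𝒜 star) {x : K} :
    x ∈ kr 𝒜 star ↔ ∃ f g : R, g ≠ 0 ∧ x = algebraMap R K f / algebraMap R K g ∧
      content 𝒜 K f ≤ star.eab (content 𝒜 K g) := by
  simp only [kr, Set.mem_ofPred_eq, content_le_eab_iff hunit hstar]

theorem kr_eab (hunit : ∃ (u : R) (α : Γ), IsUnit u ∧ u ∈ 𝒜 α ∧ α ≠ 0)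
    (hstar : PreservesHomogeneous 𝒜 star) : kr 𝒜 star = kr 𝒜 star.eab := by
  ext x
  rw [mem_kr_iff hunit hstar, kr, Set.mem_ofPred_eq]
  -- For ⋆_a the witness h = 1 suffices, since C(1) = R.
  refine exists_congr fun f => exists_congr fun g => and_congr_right fun _ => and_congr_right
    fun _ => ⟨fun h => ⟨1, one_ne_zero, ?_⟩, fun ⟨h, hh, hle⟩ => ?_⟩
  · simpa [content_one] using h
  · exact star.le_eab_of_mul_le (content_fg 𝒜 K f) (content_fg 𝒜 K g) (content_fg 𝒜 K h)
      (content_ne_bot 𝒜 K hh) hle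

/-- Membership in the Kronecker function ring does not depend on the chosen fraction. -/
theorem div_mem_kr_iff (hunit : ∃ (u : R) (α : Γ), IsUnit u ∧ u ∈ 𝒜 α ∧ α ≠ 0)
    (hstar : PreservesHomogeneous 𝒜 star) {f g : R} (hg : g ≠ 0) :
    algebraMap R K f / algebraMap R K g ∈ kr 𝒜 star ↔
      content 𝒜 K f ≤ star.eab (content 𝒜 K g) := by
  rw [mem_kr_iff hunit hstar]
  refine ⟨fun ⟨f', g', hg', e, h⟩ => ?_, fun h => ⟨f, g, hg, rfl, h⟩⟩
  rw [div_eq_div_iff (by simpa using hg) (by simpa using hg'), ← map_mul, ← map_mul] at e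
  have e' : f * g' = f' * g := IsFractionRing.injective R K e
  refine star.le_eab_of_mul_le (content_fg 𝒜 K f) (content_fg 𝒜 K g) (content_fg 𝒜 K g')
    (content_ne_bot 𝒜 K hg') ?_
  -- Up to ⋆_a, C(f)C(g') ⊆ C(fg') = C(f'g) ⊆ C(f')C(g) ⊆ C(g')C(g).
  refine (content_mul_content_le_eab 𝒜 star f g').trans ?_
  rw [← star.eab.idem (_ * _), e']
  refine star.eab.mono ((content_mul_le 𝒜 K f' g).trans ?_)
  rw [mul_comm (content 𝒜 K g)]
  exact (mul_le_mul_left h _).trans (star.eab.star_mul_le _ _)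

theorem div_mem_kr_of_content_le (hunit : ∃ (u : R) (α : Γ), IsUnit u ∧ u ∈ 𝒜 α ∧ α ≠ 0)
    (hstar : PreservesHomogeneous 𝒜 star) {f g : R}
    (h : content 𝒜 K f ≤ content 𝒜 K g) :
    algebraMap R K f / algebraMap R K g ∈ kr 𝒜 star := by
  -- The quotient by 0 is 0 here, which lies in Kr.
  by_cases hg : g = 0
  · subst hg
    rw [map_zero, div_zero, mem_kr_iff hunit hstar]
    exact ⟨0, 1, one_ne_zero, by simp, by simp⟩
  exact (div_mem_kr_iff hunit hstar hg).2 (h.trans (star.eab.le_self _))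

theorem algebraMap_mem_kr (hunit : ∃ (u : R) (α : Γ), IsUnit u ∧ u ∈ 𝒜 α ∧ α ≠ 0)
    (hstar : PreservesHomogeneous 𝒜 star) (f : R) : algebraMap R K f ∈ kr 𝒜 star := by
  have := div_mem_kr_of_content_le hunit hstar (f := f) (g := 1) (K := K)
    (by rw [content_one]; exact content_le_one 𝒜 K f)
  simpa using this

/-- The Kronecker function ring `Kr(R, ⋆)`. -/
def krSubring (hunit : ∃ (u : R) (α : Γ), IsUnit u ∧ u ∈ 𝒜 α ∧ α ≠ 0)
    (hstar : PreservesHomogeneous 𝒜 star) : Subring K where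
  carrier := kr 𝒜 star
  zero_mem' := by simpa using algebraMap_mem_kr hunit hstar 0
  one_mem' := by simpa using algebraMap_mem_kr hunit hstar 1
  neg_mem' := by
    intro x hx
    rw [mem_kr_iff hunit hstar] at hx ⊢
    obtain ⟨f, g, hg, rfl, h⟩ := hx
    exact ⟨-f, g, hg, by rw [map_neg, neg_div], by rwa [content_neg]⟩
  mul_mem' := by
    intro x y hx hy
    rw [mem_kr_iff hunit hstar] at hx hy ⊢
    obtain ⟨f, g, hg, rfl, h⟩ := hx
    obtain ⟨f', g', hg', rfl, h'⟩ := hy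
    refine ⟨f * f', g * g', mul_ne_zero hg hg', by rw [map_mul, map_mul, div_mul_div_comm], ?_⟩
    calc content 𝒜 K (f * f') ≤ content 𝒜 K f * content 𝒜 K f' := content_mul_le 𝒜 K f f'
      _ ≤ star.eab (content 𝒜 K g) * star.eab (content 𝒜 K g') := mul_le_mul' h h'
      _ ≤ star.eab (content 𝒜 K g * content 𝒜 K g') := star.eab.star_mul_star_le _ _
      _ ≤ star.eab (star.eab (content 𝒜 K (g * g'))) :=
        star.eab.mono (content_mul_content_le_eab 𝒜 star g g')
      _ = _ := star.eab.idem _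
  add_mem' := by
    intro x y hx hy
    rw [mem_kr_iff hunit hstar] at hx hy ⊢
    obtain ⟨f, g, hg, rfl, h⟩ := hx
    obtain ⟨f', g', hg', rfl, h'⟩ := hy
    refine ⟨f * g' + g * f', g * g', mul_ne_zero hg hg', ?_, ?_⟩
    · rw [div_add_div _ _ (by simpa using hg) (by simpa using hg')]
      simp
    · have h1 : content 𝒜 K (f * g') ≤ star.eab (content 𝒜 K g * content 𝒜 K g') :=
        (content_mul_le 𝒜 K f g').trans
          ((mul_le_mul_left h _).trans (star.eab.star_mul_le _ _))
      have h2 : content 𝒜 K (g * f') ≤ star.eab (content 𝒜 K g * content 𝒜 K g') :=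
        (content_mul_le 𝒜 K g f').trans
          ((mul_le_mul_right h' _).trans (star.eab.mul_star_le _ _))
      calc content 𝒜 K (f * g' + g * f') ≤ _ := content_add_le 𝒜 K _ _
        _ ≤ star.eab (content 𝒜 K g * content 𝒜 K g') := sup_le h1 h2
        _ ≤ star.eab (star.eab (content 𝒜 K (g * g'))) :=
          star.eab.mono (content_mul_content_le_eab 𝒜 star g g')
        _ = _ := star.eab.idem _

/-! ### Ideals of the Kronecker function ring. -/

section span

variable (hunit : ∃ (u : R) (α : Γ), IsUnit u ∧ u ∈ 𝒜 α ∧ α ≠ 0)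
  (hstar : PreservesHomogeneous 𝒜 star)

theorem algebraMap_mem_span_singleton_of_content_le {f g : R}
    (hg : g ≠ 0) (h : content 𝒜 K f ≤ star.eab (content 𝒜 K g)) :
    algebraMap R K f ∈ Submodule.span (krSubring hunit hstar) {algebraMap R K g} := by
  rw [Submodule.mem_span_singleton]
  refine ⟨⟨_, (div_mem_kr_iff hunit hstar hg).2 h⟩, ?_⟩
  exact div_mul_cancel₀ _ (by simpa using hg)

theorem span_pair_eq_span_add {f g : R} (hfg : f + g ≠ 0)
    (h : star (content 𝒜 K (f + g)) = star (content 𝒜 K f ⊔ content 𝒜 K g)) :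
    Submodule.span (krSubring hunit hstar) {algebraMap R K f, algebraMap R K g} =
      Submodule.span (krSubring hunit hstar) {algebraMap R K (f + g)} := by
  have hle : content 𝒜 K f ⊔ content 𝒜 K g ≤ star.eab (content 𝒜 K (f + g)) :=
    (star.le_self _).trans (h ▸ star.star_le_eab (content_fg 𝒜 K _))
  apply le_antisymm
  · rw [Submodule.span_le, Set.insert_subset_iff, Set.singleton_subset_iff]
    exact ⟨algebraMap_mem_span_singleton_of_content_le hunit hstar hfg (le_sup_left.trans hle),
      algebraMap_mem_span_singleton_of_content_le hunit hstar hfg (le_sup_right.trans hle)⟩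
  · rw [Submodule.span_singleton_le_iff_mem, map_add]
    exact add_mem (Submodule.subset_span (by simp)) (Submodule.subset_span (by simp))

theorem span_singleton_eq_span_content (f : R) :
    Submodule.span (krSubring hunit hstar) {algebraMap R K f} =
      Submodule.span (krSubring hunit hstar) (content 𝒜 K f : Set K) := by
  apply le_antisymm
  · rw [Submodule.span_singleton_le_iff_mem]
    exact Submodule.subset_span (mem_content_self 𝒜 K f)
  · rw [Submodule.span_le]
    intro x hx
    obtain ⟨r, rfl⟩ := Submodule.mem_one.1 (content_le_one 𝒜 K f hx)
    by_cases hf : f = 0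
    · rw [hf, content_zero, SetLike.mem_coe, Submodule.mem_bot] at hx
      rw [hx]
      exact zero_mem _
    · exact algebraMap_mem_span_singleton_of_content_le hunit hstar hf
        (content_le_eab_of_mem hunit hstar (star.eab.le_self _ hx))

theorem isBezout_krSubring : IsBezout (krSubring hunit hstar) := by
  obtain ⟨u, α, hu, huα, hα⟩ := id hunit
  rw [IsBezout.iff_span_pair_isPrincipal]
  rintro ⟨x, hx⟩ ⟨y, hy⟩
  obtain ⟨d, f, g, hd, rfl, rfl⟩ : ∃ d f g : R, d ≠ 0 ∧ x = algebraMap R K f / algebraMap R K d ∧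
      y = algebraMap R K g / algebraMap R K d := by
    obtain ⟨f, d, hd, rfl⟩ := IsFractionRing.div_surjective (A := R) x
    obtain ⟨g, e, he, rfl⟩ := IsFractionRing.div_surjective (A := R) y
    have hd0 := nonZeroDivisors.ne_zero hd
    have he0 := nonZeroDivisors.ne_zero he
    have hdK : algebraMap R K d ≠ 0 := by simpa using hd0
    have heK : algebraMap R K e ≠ 0 := by simpa using he0
    refine ⟨d * e, f * e, g * d, mul_ne_zero hd0 he0, ?_, ?_⟩ <;> simp only [map_mul] <;> field_simp
  have hdK : algebraMap R K d ≠ 0 := by simpa using hd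
  -- The generator is x + uⁿy: the content of f + uⁿg contains C(f) and C(g), so both quotients by f
  -- + uⁿg lie in Kr.
  obtain ⟨n, hn⟩ := exists_content_add_pow_mul_eq_sup 𝒜 K hu huα hα f g
  let Kr := krSubring hunit hstar
  let X : Kr := ⟨_, hx⟩
  let Y : Kr := ⟨_, hy⟩
  let U : Kr := ⟨_, algebraMap_mem_kr hunit hstar (u ^ n)⟩
  let Z : Kr := X + U * Y
  have hZ : (Z : K) = algebraMap R K (f + u ^ n * g) / algebraMap R K d := by
    change algebraMap R K f / algebraMap R K d + algebraMap R K (u ^ n) *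
      (algebraMap R K g / algebraMap R K d) = _
    rw [map_add, map_mul]
    ring
  have key : ∀ a : R, content 𝒜 K a ≤ content 𝒜 K (f + u ^ n * g) →
      ∃ c : Kr, algebraMap R K a / algebraMap R K d = c * Z := by
    intro a ha
    refine ⟨⟨_, div_mem_kr_of_content_le hunit hstar ha⟩, ?_⟩
    rw [hZ]
    by_cases h0 : f + u ^ n * g = 0
    · have ha0 : a = 0 := by
        by_contra hne
        rw [h0, content_zero, le_bot_iff] at ha
        exact content_ne_bot 𝒜 K hne ha
      simp [ha0]
    · have h0K : algebraMap R K (f + u ^ n * g) ≠ 0 :=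
        (map_ne_zero_iff _ (IsFractionRing.injective R K)).2 h0
      change _ = algebraMap R K a / algebraMap R K (f + u ^ n * g) * _
      field_simp
  refine ⟨Z, le_antisymm ?_ ?_⟩
  · rw [Ideal.span_le, Set.insert_subset_iff, Set.singleton_subset_iff]
    obtain ⟨c, hc⟩ := key f (hn ▸ le_sup_left)
    obtain ⟨c', hc'⟩ := key g (hn ▸ le_sup_right)
    exact ⟨Submodule.mem_span_singleton.2 ⟨c, Subtype.ext hc.symm⟩,
      Submodule.mem_span_singleton.2 ⟨c', Subtype.ext hc'.symm⟩⟩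
  · rw [Submodule.span_singleton_le_iff_mem]
    exact add_mem (Ideal.subset_span (by simp [X]))
      (Ideal.mul_mem_left _ _ (Ideal.subset_span (by simp [Y])))

end span

/-- As I ⊆ R, x maps H^⋆ into (IH)^⋆ ⊆ H^⋆. A nonzero multiple dH^⋆ lies in R^⋆, a homogeneous
submodule and so inside R_H; thus the powers of x have a common denominator over R_H. -/
theorem eab_coeSubmodule_subset_homogeneousQuotientField (hstar : PreservesHomogeneous 𝒜 star)
    {I : Ideal R} {x : K} (hx : x ∈ star.eab (IsLocalization.coeSubmodule K I)) :
    x ∈ homogeneousQuotientField 𝒜 K := by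
  obtain ⟨F, hF, -, H, hH, hH0, hxH⟩ := hx
  obtain ⟨d, hd, S, hS⟩ := exists_span_mul_eq_span_image hH
  have hF1 : F ≤ 1 := hF.trans (by
    rintro _ ⟨r, -, rfl⟩
    exact Submodule.mem_one.2 ⟨r, rfl⟩)
  have hx1 : (R ∙ x) * star H ≤ star H := by
    rw [← Submodule.span_singleton_le_iff_mem, Submodule.le_div_iff_mul_le] at hxH
    exact hxH.trans (star.mono ((mul_le_mul_left hF1 H).trans (one_mul H).le))
  have hpow : ∀ n : ℕ, ∀ y ∈ star H, y * x ^ n ∈ star H := by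
    intro n
    induction n with
    | zero => simp
    | succ n ih =>
      intro y hy
      rw [pow_succ', ← mul_assoc, mul_comm y x]
      exact ih _ (hx1 (Submodule.mul_mem_mul (Submodule.mem_span_singleton_self x) hy))
  have hdH : (R ∙ algebraMap R K d) * star H ≤ star (IsLocalization.coeSubmodule K ⊤) := by
    refine (star.mul_star_le _ _).trans (star.mono ?_)
    rw [hS, Submodule.span_le]
    rintro _ ⟨r, -, rfl⟩
    exact ⟨r, trivial, rfl⟩
  obtain ⟨y, hy, hy0⟩ := (Submodule.ne_bot_iff _).1
    (SemistarOperation.mul_ne_bot (G := R ∙ algebraMap R K d) (by simpa using hd) hH0)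
  obtain ⟨r, rfl⟩ : ∃ r : R, algebraMap R K r = y := by
    have : y ∈ (1 : Submodule R K) := by
      refine (?_ : (R ∙ algebraMap R K d) * H ≤ 1) hy
      rw [hS, Submodule.span_le]
      rintro _ ⟨r, -, rfl⟩
      exact Submodule.mem_one.2 ⟨r, rfl⟩
    exact Submodule.mem_one.1 this
  refine mem_homogeneousQuotientField_of_forall_mul_pow 𝒜 (h := r) (by rintro rfl; simp at hy0)
    fun n => ?_
  refine mem_homogeneousQuotientField_of_mem (hstar.coeSubmodule (Ideal.IsHomogeneous.top 𝒜))
    (hdH ?_)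
  obtain ⟨z, hz, hzr⟩ := Submodule.mem_span_singleton_mul.1 hy
  rw [← hzr, mul_assoc]
  exact Submodule.mul_mem_mul (Submodule.mem_span_singleton_self _)
    (hpow n z (star.le_self H hz))

theorem span_image_inter_homogeneousQuotientField
    (hunit : ∃ (u : R) (α : Γ), IsUnit u ∧ u ∈ 𝒜 α ∧ α ≠ 0)
    (hstar : PreservesHomogeneous 𝒜 star) {I : Ideal R} (hI0 : I ≠ ⊥) (hI : I.FG)
    (hI' : I.IsHomogeneous 𝒜) :
    (Submodule.span (krSubring hunit hstar) (algebraMap R K '' (I : Set R)) : Set K) ∩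
      homogeneousQuotientField 𝒜 K = (star.eab (IsLocalization.coeSubmodule K I) : Set K) := by
  obtain ⟨u, α, hu, huα, hα⟩ := id hunit
  obtain ⟨f, hf⟩ := exists_content_eq_coeSubmodule 𝒜 K hu huα hα hI hI'
  have hf0 : f ≠ 0 := by
    rintro rfl
    refine hI0 ((Submodule.eq_bot_iff I).2 fun r hr => ?_)
    have h0 : algebraMap R K r ∈ IsLocalization.coeSubmodule K I := ⟨r, hr, rfl⟩
    rw [← hf, content_zero, Submodule.mem_bot] at h0
    simpa using h0
  have himage : algebraMap R K '' (I : Set R) = (content 𝒜 K f : Set K) := by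
    rw [hf]
    rfl
  rw [himage, ← span_singleton_eq_span_content hunit hstar f, ← hf]
  -- Because s is homogeneous, C(sf) = sC(f) exactly, so the denominator passes through ⋆_a.
  have key : ∀ (a s : R), SetLike.IsHomogeneousElem 𝒜 s → s ≠ 0 →
      (algebraMap R K a / algebraMap R K s ∈
          Submodule.span (krSubring hunit hstar) {algebraMap R K f} ↔
        algebraMap R K a / algebraMap R K s ∈ star.eab (content 𝒜 K f)) := by
    intro a s hs hs0
    have hsK : algebraMap R K s ≠ 0 := by simpa using hs0
    have hfK : algebraMap R K f ≠ 0 := by simpa using hf0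
    have h1 : algebraMap R K a / algebraMap R K s ∈
        Submodule.span (krSubring hunit hstar) {algebraMap R K f} ↔
        algebraMap R K a / algebraMap R K (s * f) ∈ kr 𝒜 star := by
      rw [Submodule.mem_span_singleton, map_mul, ← div_div]
      constructor
      · rintro ⟨⟨c, hc⟩, e⟩
        rw [← e]
        change c * algebraMap R K f / algebraMap R K f ∈ _
        rwa [mul_div_cancel_right₀ _ hfK]
      · exact fun h => ⟨⟨_, h⟩, div_mul_cancel₀ _ hfK⟩
    have h2 : star.eab (content 𝒜 K (s * f)) =
        (R ∙ algebraMap R K s) * star.eab (content 𝒜 K f) := by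
      rw [content_homogeneous_mul K hs, star.eab.star_span_singleton_mul hsK]
    rw [h1, div_mem_kr_iff hunit hstar (mul_ne_zero hs0 hf0)]
    have h3 : content 𝒜 K a ≤ star.eab (content 𝒜 K (s * f)) ↔
        algebraMap R K a ∈ star.eab (content 𝒜 K (s * f)) :=
      ⟨fun h => h (mem_content_self 𝒜 K a), content_le_eab_of_mem hunit hstar⟩
    rw [h3, h2, Submodule.mem_span_singleton_mul]
    constructor
    · rintro ⟨z, hz, e⟩
      rwa [← e, mul_div_cancel_left₀ _ hsK]
    · exact fun h => ⟨_, h, mul_div_cancel₀ _ hsK⟩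
  ext x
  constructor
  · rintro ⟨hx, a, s, hs, hs0, rfl⟩
    exact (key a s hs hs0).1 hx
  · intro hx
    have hxH : x ∈ homogeneousQuotientField 𝒜 K := by
      refine eab_coeSubmodule_subset_homogeneousQuotientField hstar (I := I) ?_
      rwa [← hf]
    obtain ⟨a, s, hs, hs0, rfl⟩ := id hxH
    exact ⟨(key a s hs hs0).2 hx, hxH⟩

end GradedKronecker

theorem theorem3p3 {Γ R K : Type*} [AddCancelCommMonoid Γ] [IsAddTorsionFree Γ] [DecidableEq Γ]
    [CommRing R] [IsDomain R] (𝒜 : Γ → AddSubgroup R) [GradedRing 𝒜]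
    [Field K] [Algebra R K] [IsFractionRing R K]
    (hunit : ∃ (u : R) (α : Γ), IsUnit u ∧ u ∈ 𝒜 α ∧ α ≠ 0)
    (star : SemistarOperation R K)
    (hstar : GradedKronecker.PreservesHomogeneous 𝒜 star) :
    ∃ Kr : Subring K,
      (Kr : Set K) = GradedKronecker.kr 𝒜 star ∧
      GradedKronecker.kr 𝒜 star = GradedKronecker.kr 𝒜 star.eab ∧
      (IsDomain Kr ∧ IsBezout Kr) ∧
      (∀ I : Ideal R, I ≠ ⊥ → I.FG → I.IsHomogeneous 𝒜 →
        (Submodule.span Kr (algebraMap R K '' (I : Set R)) : Set K) ∩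
            GradedKronecker.homogeneousQuotientField 𝒜 K =
          (star.eab (IsLocalization.coeSubmodule K I) : Set K)) ∧
      (∀ f g : R, f ≠ 0 → g ≠ 0 → f + g ≠ 0 →
        star (GradedKronecker.content 𝒜 K (f + g)) =
          star (GradedKronecker.content 𝒜 K f ⊔ GradedKronecker.content 𝒜 K g) →
        Submodule.span Kr {algebraMap R K f, algebraMap R K g} =
          Submodule.span Kr {algebraMap R K (f + g)}) ∧
      (∀ f : R, Submodule.span Kr {algebraMap R K f} =
        Submodule.span Kr (GradedKronecker.content 𝒜 K f : Set K)) := by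
  exact ⟨GradedKronecker.krSubring hunit hstar, rfl, GradedKronecker.kr_eab hunit hstar,
    ⟨inferInstance, GradedKronecker.isBezout_krSubring hunit hstar⟩,
    fun _ h0 h1 h2 =>
      GradedKronecker.span_image_inter_homogeneousQuotientField hunit hstar h0 h1 h2,
    fun _ _ _ _ h h1 => GradedKronecker.span_pair_eq_span_add hunit hstar h h1,
    GradedKronecker.span_singleton_eq_span_content hunit hstar⟩
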